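/- **Setting.** Let $(M^n,g)$ be a complete connected smooth Riemannian manifold, $p$ a smooth symmetric $(0,2)$-tensor field on $M$, and $\Omega\subset M$ a bounded connected open set with smooth embedded boundary $\partial\Omega=\partial_1\Omega\,\dot\cup\,\partial_2\Omega$, where $\partial_1\Omega,\partial_2\Omega$ are disjoint, non-empty and closed, such that $$H_{\partial_1\Omega}+\operatorname{tr}_{\partial_1\Omega}(p)>0,\qquad H_{\partial_2\Omega}-\operatorname{tr}_{\partial_2\Omega}(p)>0 .$$ Here $H$ is the mean curvature, computed as the tangential divergence of the unit normal pointing out of $\Omega$, and $\operatorname{tr}_\Sigma(p)$ is the trace of $p$ over the tangent space of $\Sigma$. For $t>0$ and a $C^2$ function $u$ put $$L_tu=\Big(g^{ij}-\frac{u^iu^j}{1+|Du|^2}\Big)\Big(\frac{D_iD_ju}{\sqrt{1+|Du|^2}}+p_{ij}\Big)-tu .$$ **Constants.** Let $|p|_{C(\bar\Omega)}$ be the largest absolute value of an eigenvalue of $p$ with respect to $g$ over $\bar\Omega$, and fix $C>n|p|_{C(\bar\Omega)}$, $\chi\in(0,C)$ and $\delta\in(0,\tfrac15\operatorname{dist}(\partial_1\Omega,\partial_2\Omega))$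 such that for $i=1,2$ and every $\gamma\in[0,2\delta]$ the distance surface $\partial_{i,\gamma}\Omega=\{x\in\bar\Omega:\operatorname{dist}(x,\partial_i\Omega)=\gamma\}$ is a smooth embedded hypersurface bounding $\{x\in\Omega:\operatorname{dist}(x,\partial_i\Omega)>\gamma\}$, and, with respect to the unit normal pointing out of this set (i.e. towards $\partial_i\Omega$), $$H_{\partial_{1,\gamma}\Omega}+\operatorname{tr}_{\partial_{1,\gamma}\Omega}(p)\ge2\chi,\qquad H_{\partial_{2,\gamma}\Omega}-\operatorname{tr}_{\partial_{2,\gamma}\Omega}(p)\ge2\chi .$$ For $x\in\Omega$ let $r_0(x)>0$ be so small that for all $r\in(0,r_0(x))$ the geodesic sphere $\partial B(x,r)$ is smooth with outward mean curvature $>3C$, and put $$r_D(x)=\min\big\{\tfrac12\min\{\operatorname{inj}_x(M,g),\operatorname{dist}(x,\partial\Omega),r_0(x)\},\ \delta\big\}.$$ **Perron sub and super solutions.** A function $\underline u\in C(\bar\Omega)$ with $|\underline u|\le C/t$ is a *Perron sub solution* of $L_t$ on $\Omega$ if for all $x\in\Omega$ and $r\in(0,r_D(x))$, every $w\in C(\bar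 B(x,r))\cap C^2(B(x,r))$ with $L_tw=0$ in $B(x,r)$ and $w=\underline u$ on $\partial B(x,r)$ satisfies $w\ge\underline u$ on $\bar B(x,r)$. A function $\bar u\in C(\bar\Omega)$ with $|\bar u|\le C/t$ is a *Perron super solution* if for all such $x,r$, every such $w$ with $L_tw=0$ in $B(x,r)$ and $w=\bar u$ on $\partial B(x,r)$ satisfies $w\le\bar u$ on $\bar B(x,r)$. **Statement.** There is $t_0>0$ such that for every $t\in(0,t_0)$ the functions $$\underline u_t(x)=\begin{cases}\frac{\chi}{t}-\frac{\chi+C}{t\delta}\operatorname{dist}(x,\partial\Omega)&\text{if }\operatorname{dist}(x,\partial_1\Omega)\le\delta,\\-\frac Ct&\text{if }\operatorname{dist}(x,\partial_1\Omega)>\delta,\end{cases}\qquad \bar u_t(x)=\begin{cases}-\frac{\chi}{t}+\frac{\chi+C}{t\delta}\operatorname{dist}(x,\partial\Omega)&\text{if }\operatorname{dist}(x,\partial_2\Omega)\le\delta,\\\frac Ct&\text{if }\operatorname{dist}(x,\partial_2\Omega)>\delta\end{cases}$$ are, respectively, a Perron sub solution and a Perron super solution of $L_t$ on $\Omega$ (in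 particular they are continuous on $\bar\Omega$). Moreover $\underline u_t<\bar u_t$ on $\Omega$; $\underline u_t\ge\frac{\chi}{2t}$ at every $x\in\bar\Omega$ with $\operatorname{dist}(x,\partial_1\Omega)\le\frac{\chi\delta}{2(\chi+C)}$; and $\bar u_t\le-\frac{\chi}{2t}$ at every $x\in\bar\Omega$ with $\operatorname{dist}(x,\partial_2\Omega)\le\frac{\chi\delta}{2(\chi+C)}$. -/

import Mathlib

open Set Filter Topology Manifold Bundle
open scoped ContDiff ENNReal

namespace JangPerron

noncomputable section

variable {n : ℕ} {M : Type*}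

/-! ### Riemannian preliminaries

`M` is an `n`-dimensional manifold whose tangent spaces carry Mathlib's `RiemannianBundle` inner
product; `‖·‖` and `inner ℝ` on `TangentSpace (𝓡 n) x` are those of the metric `g`. -/

section Riemannian

variable [TopologicalSpace M] [ChartedSpace (EuclideanSpace ℝ (Fin n)) M]

instance finiteDimensionalTangentSpace (x : M) :
    FiniteDimensional ℝ (TangentSpace (𝓡 n) x) :=
  inferInstanceAs (FiniteDimensional ℝ (EuclideanSpace ℝ (Fin n)))

/-- The coordinate vector of a tangent vector at `x` in the preferred chart at `x`. In Mathlib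
`TangentSpace (𝓡 n) x` is `EuclideanSpace ℝ (Fin n)` as a vector space, identified through this
chart, so that this map and its inverse `tangentVec` are the identity. -/
def coordVec (x : M) (v : TangentSpace (𝓡 n) x) : EuclideanSpace ℝ (Fin n) := v

/-- The tangent vector at `x` with coordinate vector `v` in the preferred chart at `x`. -/
def tangentVec (x : M) (v : EuclideanSpace ℝ (Fin n)) : TangentSpace (𝓡 n) x := v

variable [RiemannianBundle (fun x : M => TangentSpace (𝓡 n) x)]

instance completeTangentSpace (x : M) : CompleteSpace (TangentSpace (𝓡 n) x) :=
  FiniteDimensional.complete ℝ _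

/-- The coefficients of the metric in the preferred chart at `x`: for a point `y` of the chart
target, `g_y(∂_v, ∂_w)`, where `∂_v`, `∂_w` are the coordinate vector fields of `v`, `w`. -/
def chartMetric (x : M) (y v w : EuclideanSpace ℝ (Fin n)) : ℝ :=
  inner ℝ (mfderiv 𝓘(ℝ, EuclideanSpace ℝ (Fin n)) (𝓡 n) (extChartAt (𝓡 n) x).symm y v)
    (mfderiv 𝓘(ℝ, EuclideanSpace ℝ (Fin n)) (𝓡 n) (extChartAt (𝓡 n) x).symm y w)

/-- The Christoffel symbols of the first kind at `x`, in the preferred chart at `x`: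
`⟨Γ(v, w), z⟩ = (∂_v g(w, z) + ∂_w g(v, z) - ∂_z g(v, w)) / 2`. -/
def christoffel (x : M) (v w z : EuclideanSpace ℝ (Fin n)) : ℝ :=
  (fderiv ℝ (fun y => chartMetric x y w z) (extChartAt (𝓡 n) x x) v
    + fderiv ℝ (fun y => chartMetric x y v z) (extChartAt (𝓡 n) x x) w
    - fderiv ℝ (fun y => chartMetric x y v w) (extChartAt (𝓡 n) x x) z) / 2

variable (n) in
/-- The Riemannian gradient `D u` at `x`. -/
def grad (u : M → ℝ) (x : M) : TangentSpace (𝓡 n) x :=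
  (InnerProductSpace.toDual ℝ (TangentSpace (𝓡 n) x)).symm (mvfderiv (𝓡 n) u x)

variable (n) in
/-- The Hessian `D_i D_j u` (Levi-Civita connection) at `x`: in the preferred chart at `x` it is
`∂_v ∂_w u - du(Γ(v, w))`, and `du(Γ(v, w)) = ⟨Γ(v, w), D u⟩`. -/
def hess (u : M → ℝ) (x : M) (v w : TangentSpace (𝓡 n) x) : ℝ :=
  fderiv ℝ (fderiv ℝ (u ∘ (extChartAt (𝓡 n) x).symm)) (extChartAt (𝓡 n) x x)
      (coordVec x v) (coordVec x w)
    - christoffel x (coordVec x v) (coordVec x w) (coordVec x (grad n u x))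

/-- The metric trace `g^{ij} B_{ij}` of a bilinear form on the tangent space at `x`. -/
def metricTrace (x : M) (B : TangentSpace (𝓡 n) x → TangentSpace (𝓡 n) x → ℝ) : ℝ :=
  ∑ i, B (stdOrthonormalBasis ℝ (TangentSpace (𝓡 n) x) i)
    (stdOrthonormalBasis ℝ (TangentSpace (𝓡 n) x) i)

variable (n) in
/-- `mc(u) = (g^{ij} - u^i u^j / (1 + |Du|²)) D_i D_j u / √(1 + |Du|²)`: the mean curvature of the
graph of `u` with respect to the downward unit normal. -/
def graphMC (u : M → ℝ) (x : M) : ℝ :=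
  (metricTrace x (hess n u x)
    - hess n u x (grad n u x) (grad n u x) / (1 + ‖grad n u x‖ ^ 2))
    / Real.sqrt (1 + ‖grad n u x‖ ^ 2)

/-- `tr(p)(u) = (g^{ij} - u^i u^j / (1 + |Du|²)) p_{ij}`: the trace of `p` over the tangent space
of the graph of `u`. -/
def graphTrace
    (p : ∀ x : M, TangentSpace (𝓡 n) x →L[ℝ] TangentSpace (𝓡 n) x →L[ℝ] ℝ)
    (u : M → ℝ) (x : M) : ℝ :=
  metricTrace x (fun v w => p x v w)
    - p x (grad n u x) (grad n u x) / (1 + ‖grad n u x‖ ^ 2)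

/-- The regularized Jang operator `L_t u = (mc + tr(p) - t) u`. -/
def jangOp
    (p : ∀ x : M, TangentSpace (𝓡 n) x →L[ℝ] TangentSpace (𝓡 n) x →L[ℝ] ℝ)
    (t : ℝ) (u : M → ℝ) (x : M) : ℝ :=
  graphMC n u x + graphTrace p u x - t * u x

variable (n) in
/-- The mean curvature at `y` of the level set of `φ` through `y`, as the tangential divergence
of the unit normal `Dφ / |Dφ|`. -/
def levelMC (φ : M → ℝ) (y : M) : ℝ :=
  (metricTrace y (hess n φ y)
    - hess n φ y (grad n φ y) (grad n φ y) / ‖grad n φ y‖ ^ 2) / ‖grad n φ y‖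

/-- The trace of `p` over the tangent space at `y` of the level set of `φ` through `y`. -/
def levelTrace
    (p : ∀ x : M, TangentSpace (𝓡 n) x →L[ℝ] TangentSpace (𝓡 n) x →L[ℝ] ℝ)
    (φ : M → ℝ) (y : M) : ℝ :=
  metricTrace y (fun v w => p y v w)
    - p y (grad n φ y) (grad n φ y) / ‖grad n φ y‖ ^ 2

variable (n) in
/-- `φ` is a smooth defining function near `y` for the boundary of `A`: near `y`, `A` is the
sublevel set `{φ < 0}`, and `0` is a regular value. So `∂A` is a smooth embedded hypersurface near
`y` and `Dφ / |Dφ|` is its unit normal pointing out of `A`. -/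
def IsBoundaryDefining (A : Set M) (y : M) (φ : M → ℝ) : Prop :=
  φ y = 0 ∧ mvfderiv (𝓡 n) φ y ≠ 0 ∧
    ∃ U : Set M, IsOpen U ∧ y ∈ U ∧ ContMDiffOn (𝓡 n) 𝓘(ℝ) ∞ φ U ∧
      ∀ q ∈ U, q ∈ A ↔ φ q < 0

variable (n) in
/-- The curve `γ` read in the preferred chart at `γ s`. -/
def chartCurve (γ : ℝ → M) (s : ℝ) : ℝ → EuclideanSpace ℝ (Fin n) :=
  fun τ => extChartAt (𝓡 n) (γ s) (γ τ)

variable (n) in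
/-- `γ` is a geodesic on the open set `J` of times: at each time `s`, in the preferred chart at
`γ s`, one has `γ'' + Γ(γ', γ') = 0`. -/
def IsGeodesicOn (γ : ℝ → M) (J : Set ℝ) : Prop :=
  ContMDiffOn 𝓘(ℝ) (𝓡 n) ∞ γ J ∧
    ∀ s ∈ J, ∀ z : EuclideanSpace ℝ (Fin n),
      inner ℝ (tangentVec (γ s) (deriv (deriv (chartCurve n γ s)) s)) (tangentVec (γ s) z)
        + christoffel (γ s) (deriv (chartCurve n γ s) s) (deriv (chartCurve n γ s) s) z = 0

/-- The ball of radius `r` about `0` in the tangent space at `x`, for the norm of `g_x`. -/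
def tangentBall (x : M) (r : ℝ) : Set (EuclideanSpace ℝ (Fin n)) :=
  {v | ‖tangentVec x v‖ < r}

/-- `F` is the exponential map at `x` on the ball of radius `r` in the tangent space at `x`, and it
is a diffeomorphism of this ball onto its image. -/
def IsNormalBall (x : M) (r : ℝ) (F : EuclideanSpace ℝ (Fin n) → M) : Prop :=
  F 0 = x ∧
  (∀ v : EuclideanSpace ℝ (Fin n),
    IsGeodesicOn n (fun s : ℝ => F (s • v)) {s : ℝ | s • v ∈ tangentBall x r} ∧
    HasDerivAt (fun s : ℝ => extChartAt (𝓡 n) x (F (s • v))) v 0) ∧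
  InjOn F (tangentBall x r) ∧
  ContMDiffOn 𝓘(ℝ, EuclideanSpace ℝ (Fin n)) (𝓡 n) ∞ F (tangentBall x r) ∧
  ∀ v ∈ tangentBall x r,
    Function.Bijective (mfderiv 𝓘(ℝ, EuclideanSpace ℝ (Fin n)) (𝓡 n) F v)

variable (n) in
/-- The injectivity radius `inj_x(M, g)`. -/
def injRadius (x : M) : ℝ≥0∞ :=
  sSup {R | ∃ r : ℝ, 0 < r ∧ R = ENNReal.ofReal r ∧
    ∃ F : EuclideanSpace ℝ (Fin n) → M, IsNormalBall x r F}

/-- `|p|_{C(Ω̄)}`: the largest absolute value of an eigenvalue of `p` with respect to `g` across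
the closure of `Ω`. -/
def tensorSup
    (p : ∀ x : M, TangentSpace (𝓡 n) x →L[ℝ] TangentSpace (𝓡 n) x →L[ℝ] ℝ)
    (Ω : Set M) : ℝ :=
  sSup {a | ∃ x ∈ closure Ω, ∃ v : TangentSpace (𝓡 n) x, ‖v‖ = 1 ∧ a = |p x v v|}

end Riemannian

/-! ### Distances, Perron sub and super solutions -/

section Perron

variable [MetricSpace M] [ChartedSpace (EuclideanSpace ℝ (Fin n)) M]

/-- The distance between two sets. -/
def setDist (S T : Set M) : ℝ :=
  sInf {d | ∃ y ∈ S, ∃ z ∈ T, d = dist y z}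

/-- The distance surface `{x : dist(x, S) = γ}` in the closure of `Ω`. -/
def distSurface (Ω S : Set M) (γ : ℝ) : Set M :=
  {x | x ∈ closure Ω ∧ Metric.infDist x S = γ}

/-- The part of `Ω` at distance more than `γ` from `S`. For `S ⊆ ∂Ω` and `γ` small its boundary
near `distSurface Ω S γ` is that surface. -/
def distInterior (Ω S : Set M) (γ : ℝ) : Set M :=
  {x | x ∈ Ω ∧ γ < Metric.infDist x S}

variable [RiemannianBundle (fun x : M => TangentSpace (𝓡 n) x)]

variable (n) in
/-- For every `x ∈ Ω` the number `r₀ x > 0` is so small that for every `r ∈ (0, r₀ x)` the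
geodesic sphere `∂B(x, r)` is a smooth hypersurface with outward mean curvature `> 3 C`. -/
def IsMeanConvexRadius (Ω : Set M) (C : ℝ) (r₀ : M → ℝ) : Prop :=
  ∀ x ∈ Ω, 0 < r₀ x ∧ ∀ r ∈ Ioo 0 (r₀ x), ∀ y ∈ Metric.sphere x r,
    ∃ φ : M → ℝ, IsBoundaryDefining n (Metric.ball x r) y φ ∧ 3 * C < levelMC n φ y

variable (n) in
/-- `r_D(x) = min { ½ min { inj_x(M, g), dist(x, ∂Ω), r₀(x) }, δ }`. -/
def perronRadius (Ω : Set M) (r₀ : M → ℝ) (δ : ℝ) (x : M) : ℝ :=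
  min ((1 / 2) * (min (min (injRadius n x) (ENNReal.ofReal (Metric.infDist x (frontier Ω))))
    (ENNReal.ofReal (r₀ x))).toReal) δ

/-- `w` solves the Dirichlet problem `L_t w = 0` in `B(x, r)`, `w = f` on `∂B(x, r)`, with
`w` continuous on the closed ball and `C²` in the open ball. -/
structure IsDirichletSolution
    (p : ∀ x : M, TangentSpace (𝓡 n) x →L[ℝ] TangentSpace (𝓡 n) x →L[ℝ] ℝ)
    (t : ℝ) (x : M) (r : ℝ) (f w : M → ℝ) : Prop where
  continuousOn : ContinuousOn w (Metric.closedBall x r)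
  contMDiffOn : ContMDiffOn (𝓡 n) 𝓘(ℝ) 2 w (Metric.ball x r)
  eq_zero : ∀ y ∈ Metric.ball x r, jangOp p t w y = 0
  boundary : ∀ y ∈ Metric.sphere x r, w y = f y

/-- Perron sub solutions of `L_t` on `Ω`, with constant `C` and radius function `rD`. -/
structure IsPerronSub
    (p : ∀ x : M, TangentSpace (𝓡 n) x →L[ℝ] TangentSpace (𝓡 n) x →L[ℝ] ℝ)
    (Ω : Set M) (C : ℝ) (rD : M → ℝ) (t : ℝ) (u : M → ℝ) : Prop where
  continuousOn : ContinuousOn u (closure Ω)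
  bound : ∀ x ∈ closure Ω, |u x| ≤ C / t
  le_solution : ∀ x ∈ Ω, ∀ r ∈ Ioo 0 (rD x), ∀ w : M → ℝ, IsDirichletSolution p t x r u w →
    ∀ y ∈ Metric.closedBall x r, u y ≤ w y

/-- Perron super solutions of `L_t` on `Ω`, with constant `C` and radius function `rD`. -/
structure IsPerronSuper
    (p : ∀ x : M, TangentSpace (𝓡 n) x →L[ℝ] TangentSpace (𝓡 n) x →L[ℝ] ℝ)
    (Ω : Set M) (C : ℝ) (rD : M → ℝ) (t : ℝ) (u : M → ℝ) : Prop where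
  continuousOn : ContinuousOn u (closure Ω)
  bound : ∀ x ∈ closure Ω, |u x| ≤ C / t
  solution_le : ∀ x ∈ Ω, ∀ r ∈ Ioo 0 (rD x), ∀ w : M → ℝ, IsDirichletSolution p t x r u w →
    ∀ y ∈ Metric.closedBall x r, w y ≤ u y

open Classical in
/-- The barrier `u̲_t`; `S₁` is the part `∂₁Ω` of the boundary. -/
def lowerBarrier (Ω S₁ : Set M) (C χ δ t : ℝ) (x : M) : ℝ :=
  if Metric.infDist x S₁ ≤ δ then
    χ / t - (χ + C) / (t * δ) * Metric.infDist x (frontier Ω)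
  else -(C / t)

open Classical in
/-- The barrier `ū_t`; `S₂` is the part `∂₂Ω` of the boundary. -/
def upperBarrier (Ω S₂ : Set M) (C χ δ t : ℝ) (x : M) : ℝ :=
  if Metric.infDist x S₂ ≤ δ then
    -(χ / t) + (χ + C) / (t * δ) * Metric.infDist x (frontier Ω)
  else C / t

end Perron

end

end JangPerron

/-! Write `d` for the distance to `∂₁Ω` and `a = (χ + C) / (t δ)`. The lower barrier is `max (χ/t -
a d) (-C/t)`. If a Dirichlet solution `w` fell below it somewhere in a ball, `w` minus the barrier
would have a negative minimum at an interior point `y`, and `L_t w = 0` is contradicted there.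

Where `d ≥ δ`, the barrier has its least value `-C/t`, so `w` has a local minimum at `y`. Then `mc +
tr(p) ≥ -n|p| > -C > t w`.

Where `d < δ`, `w + a d` has a local minimum at `y`. No smoothness of `d` is used. Along curves that
are geodesic to second order `d` grows at most by arc length, and almost minimizing paths to `∂₁Ω`
decrease it almost at unit speed. This forces `|Dw| = a` and `D²w(Dw, Dw) ≥ 0`
(`norm_grad_eq_and_hess_nonneg`). Moreover `w ≥ w(y)` on the side of the distance surface facing
`∂₁Ω`, so a second order multiplier rule shows that the level set of `w` has the same normal as that
surface and at least its mean curvature (`levelMC_le_levelMC`); hence `H + tr(p) ≥ 2χ` for this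
level set. A graph of large slope `a` is almost vertical, so `mc + tr(p)` is nearly bounded below by
`2χ` and exceeds `χ` once `t` is small (`le_graphMC_add_graphTrace`, `eventually_lt_slope_bound`).
But it equals `t w(y)`, which is less than `χ`.

The super solution follows from the symmetry `(u, p) ↦ (-u, -p)`. Completeness enters through
Hopf–Rinow: closed balls and the closure of `Ω` are compact. -/

namespace JangPerron

noncomputable section

variable {n : ℕ} {M : Type*}

/-! ### Length spaces -/

section Length

variable [MetricSpace M] [ChartedSpace (EuclideanSpace ℝ (Fin n)) M]
  [RiemannianBundle (fun x : M => TangentSpace (𝓡 n) x)]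
  [IsRiemannianManifold (𝓡 n) M]

variable (n) in
theorem exists_path_pathELength_lt {x z : M} {ℓ : ℝ} (h : dist x z < ℓ) :
    ∃ γ : ℝ → M, γ 0 = x ∧ γ 1 = z ∧ ContMDiff 𝓘(ℝ) (𝓡 n) 1 γ ∧
      Manifold.pathELength (𝓡 n) γ 0 1 < ENNReal.ofReal ℓ := by
  have h1 : Manifold.riemannianEDist (𝓡 n) x z < ENNReal.ofReal ℓ := by
    rw [← IsRiemannianManifold.out (I := 𝓡 n) x z, edist_dist]
    exact (ENNReal.ofReal_lt_ofReal_iff (dist_nonneg.trans_lt h)).2 h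
  obtain ⟨γ, h0, h1, hs, hl, -⟩ :=
    Manifold.exists_lt_locally_constant_of_riemannianEDist_lt h1 zero_lt_one
  exact ⟨γ, h0, h1, hs, hl⟩

theorem edist_le_pathELength {γ : ℝ → M} (hγ : ContMDiff 𝓘(ℝ) (𝓡 n) 1 γ) {a b : ℝ} (hab : a ≤ b) :
    edist (γ a) (γ b) ≤ Manifold.pathELength (𝓡 n) γ a b := by
  rw [IsRiemannianManifold.out (I := 𝓡 n)]
  exact Manifold.riemannianEDist_le_pathELength hγ.contMDiffOn rfl rfl hab

/-- Two points are joined by a continuous path all of whose points almost realise equality in the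
triangle inequality. -/
theorem exists_almost_minimizing_path (n : ℕ)
    [ChartedSpace (EuclideanSpace ℝ (Fin n)) M]
    [RiemannianBundle (fun x : M => TangentSpace (𝓡 n) x)] [IsRiemannianManifold (𝓡 n) M]
    (x z : M) {η : ℝ} (hη : 0 < η) :
    ∃ γ : ℝ → M, γ 0 = x ∧ γ 1 = z ∧ Continuous γ ∧
      ∀ t ∈ Icc (0 : ℝ) 1, dist x (γ t) + dist (γ t) z < dist x z + η := by
  obtain ⟨γ, h0, h1, hs, hl⟩ := exists_path_pathELength_lt n (lt_add_of_pos_right (dist x z) hη)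
  refine ⟨γ, h0, h1, hs.continuous, fun t ht => ?_⟩
  have h2 : edist x (γ t) + edist (γ t) z < ENNReal.ofReal (dist x z + η) := by
    refine lt_of_le_of_lt ?_ hl
    rw [← Manifold.pathELength_add ht.1 ht.2]
    refine add_le_add ?_ ?_
    · simpa only [h0] using edist_le_pathELength hs ht.1
    · simpa only [h1] using edist_le_pathELength hs ht.2
  rw [edist_dist, edist_dist, ← ENNReal.ofReal_add dist_nonneg dist_nonneg] at h2
  exact (ENNReal.ofReal_lt_ofReal_iff (by positivity)).1 h2

/-- Intermediate value theorem for `dist x` along an almost minimizing path. It replaces points on a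
minimizing geodesic. -/
theorem exists_intermediate_point (n : ℕ)
    [ChartedSpace (EuclideanSpace ℝ (Fin n)) M]
    [RiemannianBundle (fun x : M => TangentSpace (𝓡 n) x)] [IsRiemannianManifold (𝓡 n) M]
    (x z : M) {s η : ℝ} (hs : s ∈ Icc 0 (dist x z))
    (hη : 0 < η) : ∃ q, dist x q = s ∧ dist q z < dist x z - s + η := by
  obtain ⟨γ, h0, h1, hc, hl⟩ := exists_almost_minimizing_path n x z hη
  have hcont : ContinuousOn (fun t => dist x (γ t)) (Icc 0 1) := by fun_prop
  obtain ⟨t, ht, hts⟩ := intermediate_value_Icc zero_le_one hcont (by simpa [h0, h1] using hs)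
  refine ⟨γ t, hts, ?_⟩
  have := hl t ht
  simp only at hts
  linarith

/-- An almost minimizing path from `x` to `z` is connected, so it crosses the frontier. -/
theorem infDist_frontier_le_dist (n : ℕ)
    [ChartedSpace (EuclideanSpace ℝ (Fin n)) M]
    [RiemannianBundle (fun x : M => TangentSpace (𝓡 n) x)] [IsRiemannianManifold (𝓡 n) M]
    {Ω : Set M} {x z : M} (hx : x ∈ Ω) (hz : z ∉ Ω) :
    Metric.infDist x (frontier Ω) ≤ dist x z := by
  refine le_of_forall_pos_lt_add fun η hη => ?_
  obtain ⟨γ, h0, h1, hc, hl⟩ := exists_almost_minimizing_path n x z hη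
  have hpre : IsPreconnected (γ '' Icc (0 : ℝ) 1) := isPreconnected_Icc.image _ hc.continuousOn
  have h0' : x ∈ γ '' Icc (0 : ℝ) 1 := ⟨0, by simp, h0⟩
  have h1' : z ∈ γ '' Icc (0 : ℝ) 1 := ⟨1, by simp, h1⟩
  obtain ⟨q, ⟨t, ht, rfl⟩, hq⟩ : (γ '' Icc (0 : ℝ) 1 ∩ frontier Ω).Nonempty := by
    by_contra hne
    have hsub : γ '' Icc (0 : ℝ) 1 ⊆ interior Ω ∪ (closure Ω)ᶜ := fun q hq => by
      by_contra hcon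
      simp only [mem_union, mem_compl_iff, not_or, not_not] at hcon
      exact hne ⟨q, hq, hcon.2, hcon.1⟩
    obtain ⟨q, -, hq1, hq2⟩ := hpre _ _ isOpen_interior isClosed_closure.isOpen_compl hsub
      ⟨x, h0', (hsub h0').resolve_right fun h => h (subset_closure hx)⟩
      ⟨z, h1', (hsub h1').resolve_left fun h => hz (interior_subset h)⟩
    exact hq2 (interior_subset_closure hq1)
  have := Metric.infDist_le_dist_of_mem (x := x) hq
  have := hl t ht
  have := dist_nonneg (x := γ t) (y := z)
  linarith

/-- Hopf–Rinow: a complete Riemannian manifold is proper. -/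
theorem properSpace_of_complete (n : ℕ)
    [ChartedSpace (EuclideanSpace ℝ (Fin n)) M]
    [RiemannianBundle (fun x : M => TangentSpace (𝓡 n) x)] [IsRiemannianManifold (𝓡 n) M]
    [CompleteSpace M] : ProperSpace M := by
  have hloc : LocallyCompactSpace M := Manifold.locallyCompact_of_finiteDimensional (𝓡 n)
  refine ⟨fun x => ?_⟩
  by_contra! hcon
  obtain ⟨r₁, hr₁⟩ := hcon
  have hmono : ∀ {r s : ℝ}, s ≤ r → IsCompact (Metric.closedBall x r) →
      IsCompact (Metric.closedBall x s) := fun h hc =>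
    hc.of_isClosed_subset Metric.isClosed_closedBall (Metric.closedBall_subset_closedBall h)
  set S : Set ℝ := {r | IsCompact (Metric.closedBall x r)} with hS
  have hne : (0 : ℝ) ∈ S := by simp [hS]
  have hbdd : BddAbove S := ⟨r₁, fun r hr => by
    by_contra! hlt
    exact hr₁ (hmono hlt.le hr)⟩
  set R := sSup S with hR
  have hR0 : 0 ≤ R := le_csSup hbdd hne
  have hlt : ∀ r < R, IsCompact (Metric.closedBall x r) := fun r hr => by
    obtain ⟨s, hs, hrs⟩ := exists_lt_of_lt_csSup ⟨0, hne⟩ hr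
    exact hmono hrs.le hs
  have hRc : IsCompact (Metric.closedBall x R) := by
    rcases hR0.eq_or_lt with h0 | hpos
    · rw [← h0]; exact hne
    refine isCompact_iff_totallyBounded_isComplete.2 ⟨?_, Metric.isClosed_closedBall.isComplete⟩
    rw [Metric.totallyBounded_iff]
    intro ε hε
    -- The smaller ball of radius `s` is compact, and every point of the ball of radius `R` lies
    -- within `ε/4 + ε/4` of it, the second term being the error of the almost minimizing path.
    set s := max 0 (R - ε / 4) with hs
    have hsR : s < R := max_lt hpos (by linarith)
    obtain ⟨t, htf, ht⟩ := Metric.totallyBounded_iff.1 (hlt s hsR).totallyBounded (ε / 2) (by positivity)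
    refine ⟨t, htf, fun q hq => ?_⟩
    obtain ⟨q', hq', hqq'⟩ : ∃ q' ∈ Metric.closedBall x s, dist q q' < ε / 2 := by
      rcases le_or_gt (dist x q) s with h | h
      · exact ⟨q, by rwa [Metric.mem_closedBall, dist_comm], by simpa using hε⟩
      obtain ⟨q', h1, h2⟩ := exists_intermediate_point n x q (s := s) (η := ε / 4)
        ⟨le_max_left _ _, h.le⟩ (by positivity)
      refine ⟨q', by rw [Metric.mem_closedBall, dist_comm, h1], ?_⟩
      have h3 : dist x q ≤ R := by rw [dist_comm]; exact hq
      have h4 : R - ε / 4 ≤ s := le_max_right _ _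
      rw [dist_comm]
      linarith
    obtain ⟨y, hy, hyq⟩ := mem_iUnion₂.1 (ht hq')
    refine mem_iUnion₂.2 ⟨y, hy, ?_⟩
    rw [Metric.mem_ball] at hyq ⊢
    linarith [dist_triangle q q' y]
  -- Local compactness enlarges the compact ball of radius `R` to one of larger radius, against the
  -- choice of `R`.
  obtain ⟨L, hL, hsub⟩ := exists_compact_superset hRc
  obtain ⟨δ, hδ, hth⟩ := hRc.exists_thickening_subset_open isOpen_interior hsub
  have hbig : IsCompact (Metric.closedBall x (R + δ / 4)) := by
    refine hL.of_isClosed_subset Metric.isClosed_closedBall fun q hq => ?_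
    refine interior_subset (hth ?_)
    rw [Metric.mem_thickening_iff]
    rcases le_or_gt (dist x q) R with h | h
    · exact ⟨q, by rwa [Metric.mem_closedBall, dist_comm], by simpa using hδ⟩
    obtain ⟨q', h1, h2⟩ := exists_intermediate_point n x q (s := R) (η := δ / 4)
      ⟨hR0, h.le⟩ (by positivity)
    refine ⟨q', by rw [Metric.mem_closedBall, dist_comm, h1], ?_⟩
    have h3 : dist x q ≤ R + δ / 4 := by rw [dist_comm]; exact hq
    rw [dist_comm]
    linarith
  have : R + δ / 4 ≤ R := le_csSup hbdd hbig
  linarith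

end Length

end

end JangPerron
namespace JangPerron
noncomputable section
variable {n : ℕ} {M : Type*}

/-! ### Tensors and differentials in the preferred chart -/

section Coordinates

theorem ContinuousAt.exists_eventually_bilin_le {X V : Type*} [TopologicalSpace X]
    [NormedAddCommGroup V] [NormedSpace ℝ V] {B : X → V →L[ℝ] V →L[ℝ] ℝ} {y : X}
    (hB : ContinuousAt B y) : ∃ K : ℝ, 0 ≤ K ∧ ∀ᶠ x in 𝓝 y, ∀ v, |B x v v| ≤ K * ‖v‖ ^ 2 := by
  refine ⟨‖B y‖ + 1, by positivity, ?_⟩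
  have h : ContinuousAt (fun x => ‖B x‖) y :=
    (continuous_norm (E := V →L[ℝ] V →L[ℝ] ℝ)).continuousAt.comp hB
  filter_upwards [h.eventually_lt_const (lt_add_one _)] with x hx v
  calc |B x v v| ≤ ‖B x‖ * ‖v‖ * ‖v‖ := (B x).le_opNorm₂ _ _
    _ ≤ (‖B y‖ + 1) * ‖v‖ * ‖v‖ := by gcongr
    _ = (‖B y‖ + 1) * ‖v‖ ^ 2 := by ring

variable [TopologicalSpace M] [ChartedSpace (EuclideanSpace ℝ (Fin n)) M]

theorem ContMDiffAt.contDiffAt_chart {y : M} {w : M → ℝ} {k : ℕ∞ω}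
    (hw : ContMDiffAt (𝓡 n) 𝓘(ℝ) k w y) :
    ContDiffAt ℝ k (w ∘ (extChartAt (𝓡 n) y).symm) (extChartAt (𝓡 n) y y) := by
  have h := contMDiffAt_iff_source.1 hw
  rw [ModelWithCorners.range_eq_univ, contMDiffWithinAt_univ] at h
  exact h.contDiffAt

variable [IsManifold (𝓡 n) ∞ M]

/-- Serves both the metric and `p`: each becomes a smooth function with values in a fixed space of
bilinear forms. -/
theorem exists_coordinates_of_contMDiff
    {g : ∀ x : M, TangentSpace (𝓡 n) x →L[ℝ] TangentSpace (𝓡 n) x →L[ℝ] ℝ}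
    (hg : ContMDiff (𝓡 n)
      ((𝓡 n).prod 𝓘(ℝ, EuclideanSpace ℝ (Fin n) →L[ℝ] EuclideanSpace ℝ (Fin n) →L[ℝ] ℝ)) ∞
      (fun x : M => TotalSpace.mk' (EuclideanSpace ℝ (Fin n) →L[ℝ] EuclideanSpace ℝ (Fin n) →L[ℝ] ℝ)
        x (g x))) (y : M) :
    ∃ B : M → EuclideanSpace ℝ (Fin n) →L[ℝ] EuclideanSpace ℝ (Fin n) →L[ℝ] ℝ,
      ContMDiffAt (𝓡 n) 𝓘(ℝ, EuclideanSpace ℝ (Fin n) →L[ℝ] EuclideanSpace ℝ (Fin n) →L[ℝ] ℝ) ∞ B y ∧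
      ∀ x ∈ (chartAt (EuclideanSpace ℝ (Fin n)) y).source, ∀ v w : EuclideanSpace ℝ (Fin n),
        B x v w =
        g x ((trivializationAt (EuclideanSpace ℝ (Fin n)) (TangentSpace (𝓡 n)) y).symmL ℝ x v)
          ((trivializationAt (EuclideanSpace ℝ (Fin n)) (TangentSpace (𝓡 n)) y).symmL ℝ x w) := by
  have h1 := hg y
  rw [contMDiffAt_hom_bundle] at h1
  refine ⟨_, h1.2, fun x hx v w => ?_⟩
  have hx' : x ∈ (trivializationAt (EuclideanSpace ℝ (Fin n)) (TangentSpace (𝓡 n)) y).baseSet := by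
    simpa using hx
  refine (inCoordinates_apply_eq₂ (E₃ := fun _ : M => ℝ) (F₃ := ℝ) hx' hx' (Set.mem_univ _)).trans ?_
  have h (v : EuclideanSpace ℝ (Fin n)) :
      (trivializationAt (EuclideanSpace ℝ (Fin n)) (TangentSpace (𝓡 n)) y).symm x v =
        (trivializationAt (EuclideanSpace ℝ (Fin n)) (TangentSpace (𝓡 n)) y).symmL ℝ x v :=
    (Trivialization.symmL_apply _ hx' _).symm
  simpa using congrArg₂ (fun a b => g x a b) (h v) (h w)

theorem symmL_trivializationAt_eq_mfderiv (y : M) {u : EuclideanSpace ℝ (Fin n)} (hu : u ∈ (extChartAt (𝓡 n) y).target) (v : EuclideanSpace ℝ (Fin n)) :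
  mfderiv 𝓘(ℝ, EuclideanSpace ℝ (Fin n)) (𝓡 n) (extChartAt (𝓡 n) y).symm u v =
   (trivializationAt (EuclideanSpace ℝ (Fin n)) (TangentSpace (𝓡 n)) y).symmL ℝ ((extChartAt (𝓡 n) y).symm u) v := by
  have hx : (extChartAt (𝓡 n) y).symm u ∈ (chartAt (EuclideanSpace ℝ (Fin n)) y).source := by
    simpa using (extChartAt (𝓡 n) y).map_target hu
  rw [TangentBundle.symmL_trivializationAt hx]
  rw [(extChartAt (𝓡 n) y).right_inv hu]
  rw [ModelWithCorners.range_eq_univ, mfderivWithin_univ]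
  rfl

/-- The coordinate change from a chart to itself is the identity. Hence `coordVec` and `tangentVec`
agree with the trivialization over the centre of the chart. -/
theorem symmL_self (y : M) (v : EuclideanSpace ℝ (Fin n)) :
   (trivializationAt (EuclideanSpace ℝ (Fin n)) (TangentSpace (𝓡 n)) y).symmL ℝ y v = tangentVec y v := by
  rw [TangentBundle.symmL_trivializationAt_eq_core (mem_chart_source _ y)]
  exact (tangentBundleCore (𝓡 n) M).coordChange_self _ _ (mem_chart_source _ y) _


theorem continuousLinearMapAt_self (y : M) (v : TangentSpace (𝓡 n) y) :
    (trivializationAt (EuclideanSpace ℝ (Fin n)) (TangentSpace (𝓡 n)) y).continuousLinearMapAt ℝ y v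
      = coordVec y v := by
  rw [TangentBundle.continuousLinearMapAt_trivializationAt_eq_core (mem_chart_source _ y)]
  exact (tangentBundleCore (𝓡 n) M).coordChange_self _ _ (mem_chart_source _ y) _

theorem symmL_continuousLinearMapAt (y : M) {x : M}
    (hx : x ∈ (chartAt (EuclideanSpace ℝ (Fin n)) y).source) (v : TangentSpace (𝓡 n) x) :
    (trivializationAt (EuclideanSpace ℝ (Fin n)) (TangentSpace (𝓡 n)) y).symmL ℝ x
      ((trivializationAt (EuclideanSpace ℝ (Fin n)) (TangentSpace (𝓡 n)) y).continuousLinearMapAt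
        ℝ x v) = v :=
  Trivialization.symmL_continuousLinearMapAt _ (by simpa using hx) v

theorem mvfderiv_eq_fderiv (y : M) {x : M}
    (hx : x ∈ (chartAt (EuclideanSpace ℝ (Fin n)) y).source) {w : M → ℝ}
    (hw : MDifferentiableAt (𝓡 n) 𝓘(ℝ) w x) (v : TangentSpace (𝓡 n) x) :
    mvfderiv (𝓡 n) w x v = fderiv ℝ (w ∘ (extChartAt (𝓡 n) y).symm) (extChartAt (𝓡 n) y x)
      ((trivializationAt (EuclideanSpace ℝ (Fin n)) (TangentSpace (𝓡 n)) y).continuousLinearMapAt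
        ℝ x v) := by
  rw [TangentBundle.continuousLinearMapAt_trivializationAt hx]
  have hx' : x ∈ (extChartAt (𝓡 n) y).source := by simpa using hx
  have h1 : MDifferentiableAt 𝓘(ℝ, EuclideanSpace ℝ (Fin n)) (𝓡 n) (extChartAt (𝓡 n) y).symm (extChartAt (𝓡 n) y x) :=
    ((contMDiffOn_extChartAt_symm (n := 1) y).contMDiffAt
      (extChartAt_target_mem_nhds' (mem_of_eq_of_mem rfl ((extChartAt (𝓡 n) y).map_source hx')))).mdifferentiableAt one_ne_zero
  have h2 : MDifferentiableAt (𝓡 n) 𝓘(ℝ) w ((extChartAt (𝓡 n) y).symm (extChartAt (𝓡 n) y x)) := by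
    rwa [(extChartAt (𝓡 n) y).left_inv hx']
  have h3 := h2.comp _ h1
  have h4 := mfderiv_comp x h3 (mdifferentiableAt_extChartAt (I := 𝓡 n) hx)
  have h5 : (w ∘ (extChartAt (𝓡 n) y).symm) ∘ (extChartAt (𝓡 n) y) =ᶠ[𝓝 x] w := by
    filter_upwards [extChartAt_source_mem_nhds' hx'] with q hq
    exact congrArg w ((extChartAt (𝓡 n) y).left_inv hq)
  rw [h5.mfderiv_eq] at h4
  rw [mvfderiv]
  rw [mfderiv_eq_fderiv] at h4
  exact congrArg (fun L => L v) h4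

variable [RiemannianBundle (fun x : M => TangentSpace (𝓡 n) x)]

theorem chartMetric_self (y : M) (v w : EuclideanSpace ℝ (Fin n)) :
    chartMetric y (extChartAt (𝓡 n) y y) v w = inner ℝ (tangentVec y v) (tangentVec y w) := by
  rw [chartMetric, symmL_trivializationAt_eq_mfderiv y (mem_extChartAt_target y),
    symmL_trivializationAt_eq_mfderiv y (mem_extChartAt_target y)]
  have h : (extChartAt (𝓡 n) y).symm (extChartAt (𝓡 n) y y) = y := extChartAt_to_inv y
  rw [h, symmL_self, symmL_self]

theorem fderiv_eq_inner_grad (y : M) {w : M → ℝ}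
    (hw : MDifferentiableAt (𝓡 n) 𝓘(ℝ) w y) (v : EuclideanSpace ℝ (Fin n)) :
    fderiv ℝ (w ∘ (extChartAt (𝓡 n) y).symm) (extChartAt (𝓡 n) y y) v =
      inner ℝ (grad n w y) (tangentVec y v) := by
  rw [grad, InnerProductSpace.toDual_symm_apply, mvfderiv_eq_fderiv y (mem_chart_source _ y) hw,
    continuousLinearMapAt_self]
  rfl

variable [IsContMDiffRiemannianBundle (𝓡 n) ∞ (EuclideanSpace ℝ (Fin n))
      (fun x : M => TangentSpace (𝓡 n) x)]

theorem exists_chartMetric_eq (y : M) :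
    ∃ B : EuclideanSpace ℝ (Fin n) → EuclideanSpace ℝ (Fin n) →L[ℝ] EuclideanSpace ℝ (Fin n) →L[ℝ] ℝ,
      DifferentiableAt ℝ B (extChartAt (𝓡 n) y y) ∧
      ∀ u ∈ (extChartAt (𝓡 n) y).target, ∀ v w, chartMetric y u v w = B u v w := by
  obtain ⟨g, hg, hgi⟩ := IsContMDiffRiemannianBundle.exists_contMDiff (IB := 𝓡 n) (n := ∞)
    (F := EuclideanSpace ℝ (Fin n)) (E := fun x : M => TangentSpace (𝓡 n) x)
  obtain ⟨B, hB, hBg⟩ := exists_coordinates_of_contMDiff hg y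
  refine ⟨B ∘ (extChartAt (𝓡 n) y).symm, ?_, fun u hu v w => ?_⟩
  · have h1 : ContMDiffAt (𝓡 n) 𝓘(ℝ, EuclideanSpace ℝ (Fin n) →L[ℝ] EuclideanSpace ℝ (Fin n) →L[ℝ] ℝ) ∞ B
        ((extChartAt (𝓡 n) y).symm (extChartAt (𝓡 n) y y)) := by
      rwa [extChartAt_to_inv]
    have h2 : ContMDiffAt 𝓘(ℝ, EuclideanSpace ℝ (Fin n)) (𝓡 n) ∞ (extChartAt (𝓡 n) y).symm
        (extChartAt (𝓡 n) y y) :=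
      (contMDiffOn_extChartAt_symm y).contMDiffAt (extChartAt_target_mem_nhds y)
    exact (h1.comp _ h2).contDiffAt.differentiableAt (by simp)
  · have hx : (extChartAt (𝓡 n) y).symm u ∈ (chartAt (EuclideanSpace ℝ (Fin n)) y).source := by
      simpa using (extChartAt (𝓡 n) y).map_target hu
    rw [chartMetric, symmL_trivializationAt_eq_mfderiv y hu, symmL_trivializationAt_eq_mfderiv y hu,
      Function.comp_apply, hBg _ hx]
    exact hgi _ _ _


theorem isContinuousRiemannianBundle : IsContinuousRiemannianBundle (EuclideanSpace ℝ (Fin n))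
    (fun x : M => TangentSpace (𝓡 n) x) := by
  obtain ⟨g, hg, hgi⟩ := IsContMDiffRiemannianBundle.exists_contMDiff (IB := 𝓡 n) (n := ∞)
    (F := EuclideanSpace ℝ (Fin n)) (E := fun x : M => TangentSpace (𝓡 n) x)
  exact ⟨g, hg.continuous, hgi⟩

/-- A smooth tensor field is locally bounded with respect to the metric. -/
theorem eventually_abs_tensor_le
    {p : ∀ x : M, TangentSpace (𝓡 n) x →L[ℝ] TangentSpace (𝓡 n) x →L[ℝ] ℝ}
    (hp : ContMDiff (𝓡 n)
      ((𝓡 n).prod 𝓘(ℝ, EuclideanSpace ℝ (Fin n) →L[ℝ] EuclideanSpace ℝ (Fin n) →L[ℝ] ℝ)) ∞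
      (fun x : M => TotalSpace.mk' (EuclideanSpace ℝ (Fin n) →L[ℝ] EuclideanSpace ℝ (Fin n) →L[ℝ] ℝ)
        x (p x))) (y : M) :
    ∃ K : ℝ, ∀ᶠ x in 𝓝 y, ∀ v : TangentSpace (𝓡 n) x, |p x v v| ≤ K * ‖v‖ ^ 2 := by
  have hcont := isContinuousRiemannianBundle (n := n) (M := M)
  obtain ⟨B, hB, hBp⟩ := exists_coordinates_of_contMDiff hp y
  obtain ⟨C, hC, hT⟩ := eventually_norm_trivializationAt_lt (EuclideanSpace ℝ (Fin n))
    (fun x : M => TangentSpace (𝓡 n) x) y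
  obtain ⟨K, hK, hBn⟩ := ContinuousAt.exists_eventually_bilin_le hB.continuousAt
  refine ⟨K * C ^ 2, ?_⟩
  filter_upwards [hT, hBn, chart_source_mem_nhds (EuclideanSpace ℝ (Fin n)) y] with x hx1 hx2 hx3 v
  set T := (trivializationAt (EuclideanSpace ℝ (Fin n)) (TangentSpace (𝓡 n)) y).continuousLinearMapAt
    ℝ x with hTdef
  have h1 := hBp x hx3 (T v) (T v)
  rw [symmL_continuousLinearMapAt y hx3] at h1
  rw [← h1]
  have h2 : ‖T v‖ ≤ C * ‖v‖ := (T.le_opNorm v).trans (by gcongr)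
  calc |B x (T v) (T v)| ≤ K * ‖T v‖ ^ 2 := hx2 _
    _ ≤ K * (C * ‖v‖) ^ 2 := by gcongr
    _ = K * C ^ 2 * ‖v‖ ^ 2 := by ring

/-- The chart differential of `w` is continuous, and carrying a vector from `x` to `y` by the
trivialization multiplies its norm by at most a factor close to `1`. Each effect is allotted half of
`η`. -/
theorem eventually_mvfderiv_le {w : M → ℝ} {y : M} (hw : ContMDiffAt (𝓡 n) 𝓘(ℝ) 1 w y)
    {η : ℝ} (hη : 0 < η) :
    ∀ᶠ x in 𝓝 y, ∀ v : TangentSpace (𝓡 n) x,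
      |mvfderiv (𝓡 n) w x v| ≤ (‖grad n w y‖ + η) * ‖v‖ := by
  have hcont := isContinuousRiemannianBundle (n := n) (M := M)
  obtain ⟨C, hC, hT⟩ := eventually_norm_trivializationAt_lt (EuclideanSpace ℝ (Fin n))
    (fun x : M => TangentSpace (𝓡 n) x) y
  have hr : 1 < 1 + η / 2 / (‖grad n w y‖ + 1) := by
    have : 0 < η / 2 / (‖grad n w y‖ + 1) := by positivity
    linarith
  have hS := eventually_norm_symmL_trivializationAt_self_comp_lt (EuclideanSpace ℝ (Fin n))
    (fun x : M => TangentSpace (𝓡 n) x) y hr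
  have hmd : ∀ᶠ x in 𝓝 y, MDifferentiableAt (𝓡 n) 𝓘(ℝ) w x := by
    filter_upwards [(contMDiffAt_iff_contMDiffAt_nhds (by simp)).1 hw] with x hx using hx.mdifferentiableAt one_ne_zero
  set F := w ∘ (extChartAt (𝓡 n) y).symm with hF
  have hF1 : ContDiffAt ℝ 1 F (extChartAt (𝓡 n) y y) := ContMDiffAt.contDiffAt_chart hw
  have hF2 : ContinuousAt (fun x => fderiv ℝ F (extChartAt (𝓡 n) y x)) y :=
    ContinuousAt.comp (g := fderiv ℝ F) (hF1.continuousAt_fderiv one_ne_zero)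
      (continuousAt_extChartAt y)
  have hF3 : ∀ᶠ x in 𝓝 y, ‖fderiv ℝ F (extChartAt (𝓡 n) y x) - fderiv ℝ F (extChartAt (𝓡 n) y y)‖
      < η / 2 / C := by
    have := (hF2.sub_const (fderiv ℝ F (extChartAt (𝓡 n) y y))).norm
    refine this.eventually_lt_const ?_
    simpa using by positivity
  filter_upwards [hT, hS, hmd, hF3, chart_source_mem_nhds (EuclideanSpace ℝ (Fin n)) y] with
    x hx1 hx2 hx3 hx4 hx5 v
  rw [mvfderiv_eq_fderiv y hx5 hx3]
  set T := (trivializationAt (EuclideanSpace ℝ (Fin n)) (TangentSpace (𝓡 n)) y).continuousLinearMapAt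
    ℝ x with hTdef
  have h2 : ‖T v‖ ≤ C * ‖v‖ := (T.le_opNorm v).trans (by gcongr)
  have h3 : |fderiv ℝ F (extChartAt (𝓡 n) y y) (T v)| ≤
      ‖grad n w y‖ * ((1 + η / 2 / (‖grad n w y‖ + 1)) * ‖v‖) := by
    rw [hF, fderiv_eq_inner_grad y hmd.self_of_nhds, ← symmL_self]
    refine (abs_real_inner_le_norm _ _).trans ?_
    gcongr
    refine (ContinuousLinearMap.le_opNorm (((trivializationAt (EuclideanSpace ℝ (Fin n))
      (TangentSpace (𝓡 n)) y).symmL ℝ y) ∘L T) v).trans ?_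
    gcongr
  have h4 : ‖grad n w y‖ * (η / 2 / (‖grad n w y‖ + 1)) ≤ η / 2 := by
    rw [mul_div_assoc', div_le_iff₀ (by positivity)]
    nlinarith [norm_nonneg (grad n w y)]
  have h5 : |fderiv ℝ F (extChartAt (𝓡 n) y x) (T v) - fderiv ℝ F (extChartAt (𝓡 n) y y) (T v)|
      ≤ η / 2 * ‖v‖ := by
    calc _ = ‖(fderiv ℝ F (extChartAt (𝓡 n) y x) - fderiv ℝ F (extChartAt (𝓡 n) y y)) (T v)‖ := rfl
      _ ≤ η / 2 / C * (C * ‖v‖) := (ContinuousLinearMap.le_opNorm _ _).trans (by gcongr)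
      _ = η / 2 * ‖v‖ := by field_simp
  have h6 := abs_add_le (fderiv ℝ F (extChartAt (𝓡 n) y x) (T v) - fderiv ℝ F (extChartAt (𝓡 n) y y) (T v))
    (fderiv ℝ F (extChartAt (𝓡 n) y y) (T v))
  rw [sub_add_cancel] at h6
  nlinarith [mul_le_mul_of_nonneg_right h4 (norm_nonneg v)]

end Coordinates

end

end JangPerron
namespace JangPerron

noncomputable section

variable {n : ℕ} {M : Type*}

/-! ### Second order expansion along a parabola -/

section Parabola

theorem exists_linearMap_eq_trilinear {V : Type*} [NormedAddCommGroup V] [NormedSpace ℝ V]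
    (T : V →L[ℝ] V →L[ℝ] V →L[ℝ] ℝ) (v : V) :
    ∃ L : V →ₗ[ℝ] ℝ, ∀ z, L z = (T v v z + T v v z - T z v v) / 2 :=
  ⟨(2 : ℝ)⁻¹ • ((T v v : V →ₗ[ℝ] ℝ) + (T v v : V →ₗ[ℝ] ℝ) - (((T.flip v).flip v : V →L[ℝ] ℝ) : V →ₗ[ℝ] ℝ)),
    fun z => by simp; ring⟩

/-- The parabola through `c` with velocity `v` and acceleration `b`. -/
theorem hasDerivAt_parabola {V : Type*} [NormedAddCommGroup V] [NormedSpace ℝ V] (c v b : V) (s : ℝ) :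
    HasDerivAt (fun s : ℝ => c + s • v + (s ^ 2 / 2) • b) (v + s • b) s := by
  have h1 : HasDerivAt (fun s : ℝ => s • v) ((1 : ℝ) • v) s := (hasDerivAt_id s).smul_const v
  have h2 : HasDerivAt (fun s : ℝ => (s ^ 2 / 2) • b) (s • b) s := by
    have : HasDerivAt (fun s : ℝ => s ^ 2 / 2) s s := by
      simpa using (hasDerivAt_pow 2 s).div_const 2
    exact this.smul_const b
  rw [one_smul] at h1
  exact (h1.const_add c).add h2

theorem hasDerivAt_comp_parabola {V W : Type*} [NormedAddCommGroup V] [NormedSpace ℝ V]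
    [NormedAddCommGroup W] [NormedSpace ℝ W]
    {B : V → W} {c : V} (hB : DifferentiableAt ℝ B c) (v b : V) :
    HasDerivAt (fun t : ℝ => B (c + t • v + (t ^ 2 / 2) • b)) (fderiv ℝ B c v) 0 := by
  have h := hasDerivAt_parabola c v b 0
  rw [zero_smul, add_zero] at h
  exact hB.hasFDerivAt.comp_hasDerivAt_of_eq (0 : ℝ) h (by simp)

set_option synthInstance.maxHeartbeats 200000 in
theorem hasDerivAt_bilin_parabola {V : Type*} [NormedAddCommGroup V] [NormedSpace ℝ V]
    {B : V → V →L[ℝ] V →L[ℝ] ℝ} {c : V} (hB : DifferentiableAt ℝ B c) (v b : V) :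
    HasDerivAt (fun t : ℝ => B (c + t • v + (t ^ 2 / 2) • b) (v + t • b) (v + t • b))
      (fderiv ℝ B c v v v + B c b v + B c v b) 0 := by
  have h1 := hasDerivAt_comp_parabola (W := V →L[ℝ] V →L[ℝ] ℝ) hB v b
  have h2 : HasDerivAt (fun t : ℝ => v + t • b) b 0 := by
    simpa using ((hasDerivAt_id (0 : ℝ)).smul_const b).const_add v
  refine ((h1.clm_apply h2).clm_apply h2).congr_deriv ?_
  simp

/-- Peano form of Taylor's formula: only differentiability of `h'` at `0` is needed, so it applies
to `C²` functions. The remainder has derivative at most `ε|s|` on `[-|s|, |s|]`, and the mean value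
inequality concludes. -/
theorem eventually_abs_taylor_two_le {h h' : ℝ → ℝ} {m : ℝ}
    (hh : ∀ᶠ s in 𝓝 (0 : ℝ), HasDerivAt h (h' s) s) (hh' : HasDerivAt h' m 0)
    {ε : ℝ} (hε : 0 < ε) :
    ∀ᶠ s in 𝓝 (0 : ℝ), |h s - h 0 - s * h' 0 - s ^ 2 / 2 * m| ≤ ε * s ^ 2 := by
  have h1 := (hasDerivAt_iff_isLittleO.1 hh').def hε
  obtain ⟨ρ, hρ, hball⟩ := Metric.eventually_nhds_iff.1 (h1.and hh)
  refine Metric.eventually_nhds_iff.2 ⟨ρ, hρ, fun s hs => ?_⟩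
  rw [Real.dist_eq, sub_zero] at hs
  set k : ℝ → ℝ := fun t => h t - h 0 - t * h' 0 - t ^ 2 / 2 * m with hk
  have hkd (t : ℝ) (ht : t ∈ Icc (-|s|) |s|) : HasDerivWithinAt k (h' t - h' 0 - t * m) (Icc (-|s|) |s|) t := by
    have h2 := (hball (y := t) (by
      rw [Real.dist_eq, sub_zero]; exact (abs_le.2 ht).trans_lt hs)).2
    have h3 : HasDerivAt (fun t : ℝ => t ^ 2 / 2 * m) (t * m) t := by
      have : HasDerivAt (fun s : ℝ => s ^ 2 / 2) t t := by
        simpa using (hasDerivAt_pow 2 t).div_const 2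
      exact this.mul_const m
    have h4 : HasDerivAt (fun t : ℝ => t * h' 0) (h' 0) t := by
      simpa using (hasDerivAt_id t).mul_const (h' 0)
    exact (((h2.sub_const (h 0)).sub h4).sub h3).hasDerivWithinAt
  have hbd (t : ℝ) (ht : t ∈ Icc (-|s|) |s|) : ‖h' t - h' 0 - t * m‖ ≤ ε * |s| := by
    have h2 := (hball (y := t) (by
      rw [Real.dist_eq, sub_zero]; exact (abs_le.2 ht).trans_lt hs)).1
    simp only [sub_zero, smul_eq_mul] at h2
    refine h2.trans ?_
    rw [Real.norm_eq_abs]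
    exact mul_le_mul_of_nonneg_left (abs_le.2 ht) hε.le
  have h5 := (convex_Icc (-|s|) |s|).norm_image_sub_le_of_norm_hasDerivWithin_le hkd hbd
    (x := 0) (y := s) ⟨by simp, abs_nonneg s⟩ ⟨neg_abs_le s, le_abs_self s⟩
  have h6 : k 0 = 0 := by simp [hk]
  rw [h6, sub_zero, sub_zero, Real.norm_eq_abs, Real.norm_eq_abs, mul_assoc, ← pow_two, sq_abs] at h5
  exact h5

theorem eventually_abs_parabola_le {V : Type*} [NormedAddCommGroup V] [NormedSpace ℝ V]
    {F : V → ℝ} {c : V} (hF : ContDiffAt ℝ 2 F c) (v b : V) {ε : ℝ} (hε : 0 < ε) :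
    ∀ᶠ s in 𝓝 (0 : ℝ), |F (c + s • v + (s ^ 2 / 2) • b) - F c - s * fderiv ℝ F c v
      - s ^ 2 / 2 * (fderiv ℝ (fderiv ℝ F) c v v + fderiv ℝ F c b)| ≤ ε * s ^ 2 := by
  set σ : ℝ → V := fun s => c + s • v + (s ^ 2 / 2) • b with hσ
  have hσ0 : σ 0 = c := by simp [hσ]
  have hσd (s : ℝ) : HasDerivAt σ (v + s • b) s := hasDerivAt_parabola c v b s
  have hσc : ContinuousAt σ 0 := (hσd 0).continuousAt
  have hFd : ∀ᶠ u in 𝓝 c, DifferentiableAt ℝ F u := by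
    filter_upwards [hF.eventually (by simp)] with u hu using hu.differentiableAt two_ne_zero
  have h1 : ∀ᶠ s in 𝓝 (0 : ℝ), HasDerivAt (F ∘ σ) (fderiv ℝ F (σ s) (v + s • b)) s := by
    filter_upwards [hσc.eventually (by rw [hσ0]; exact hFd)] with s hs
    exact hs.hasFDerivAt.comp_hasDerivAt s (hσd s)
  have hF2 : DifferentiableAt ℝ (fderiv ℝ F) c :=
    (hF.fderiv_right (m := 1) (by norm_num)).differentiableAt one_ne_zero
  have h2 : HasDerivAt (fun s => fderiv ℝ F (σ s) (v + s • b))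
      (fderiv ℝ (fderiv ℝ F) c v v + fderiv ℝ F c b) 0 := by
    have h3 := hasDerivAt_comp_parabola hF2 v b
    have h4 : HasDerivAt (fun t : ℝ => v + t • b) b 0 := by
      simpa using ((hasDerivAt_id (0 : ℝ)).smul_const b).const_add v
    refine (h3.clm_apply h4).congr_deriv ?_
    simp
  simpa [hσ0] using eventually_abs_taylor_two_le h1 h2 hε

end Parabola

/-! ### Distances and curves -/

section Curves

variable [MetricSpace M] [ChartedSpace (EuclideanSpace ℝ (Fin n)) M] [IsManifold (𝓡 n) ∞ M]
  [RiemannianBundle (fun x : M => TangentSpace (𝓡 n) x)]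
  [IsContMDiffRiemannianBundle (𝓡 n) ∞ (EuclideanSpace ℝ (Fin n))
    (fun x : M => TangentSpace (𝓡 n) x)]

theorem exists_chartMetric_christoffel (y : M) :
    ∃ B : EuclideanSpace ℝ (Fin n) → EuclideanSpace ℝ (Fin n) →L[ℝ] EuclideanSpace ℝ (Fin n) →L[ℝ] ℝ,
      DifferentiableAt ℝ B (extChartAt (𝓡 n) y y) ∧
      (∀ u ∈ (extChartAt (𝓡 n) y).target, ∀ v w, chartMetric y u v w = B u v w) ∧
      ∀ v w z, christoffel y v w z = (fderiv ℝ B (extChartAt (𝓡 n) y y) v w z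
        + fderiv ℝ B (extChartAt (𝓡 n) y y) w v z - fderiv ℝ B (extChartAt (𝓡 n) y y) z v w) / 2 := by
  obtain ⟨B, hB, hBg⟩ := exists_chartMetric_eq (n := n) y
  refine ⟨B, hB, hBg, fun v w z => ?_⟩
  have key (a b e : EuclideanSpace ℝ (Fin n)) :
      fderiv ℝ (fun u => chartMetric y u a b) (extChartAt (𝓡 n) y y) e
        = fderiv ℝ B (extChartAt (𝓡 n) y y) e a b := by
    have h1 : (fun u => chartMetric y u a b) =ᶠ[𝓝 (extChartAt (𝓡 n) y y)] fun u => B u a b := by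
      filter_upwards [extChartAt_target_mem_nhds (I := 𝓡 n) y] with u hu using hBg u hu a b
    have h2 := (hB.hasFDerivAt.clm_apply (hasFDerivAt_const a (extChartAt (𝓡 n) y y))).clm_apply
      (hasFDerivAt_const b (extChartAt (𝓡 n) y y))
    rw [h1.fderiv_eq, h2.fderiv]
    simp
  rw [christoffel, key, key, key]

/-- Riesz representation gives the vector `b = Γ(v, v)`. The parabola with velocity `v` and
acceleration `-b` satisfies the geodesic equation at time `0`. -/
theorem exists_inner_eq_christoffel (y : M) (v : EuclideanSpace ℝ (Fin n)) :
    ∃ b : EuclideanSpace ℝ (Fin n), ∀ z : EuclideanSpace ℝ (Fin n),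
      inner ℝ (tangentVec y b) (tangentVec y z) = christoffel y v v z := by
  obtain ⟨B, -, -, hΓ⟩ := exists_chartMetric_christoffel (n := n) y
  obtain ⟨L, hL⟩ := exists_linearMap_eq_trilinear (fderiv ℝ B (extChartAt (𝓡 n) y y)) v
  let ℓ : TangentSpace (𝓡 n) y →ₗ[ℝ] ℝ :=
    { toFun := fun z => christoffel y v v (coordVec y z)
      map_add' := fun a b => by
        simp only [hΓ, ← hL]
        exact L.map_add (coordVec y a) (coordVec y b)
      map_smul' := fun r a => by
        simp only [hΓ, ← hL]
        exact L.map_smul r (coordVec y a) }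
  refine ⟨coordVec y ((InnerProductSpace.toDual ℝ (TangentSpace (𝓡 n) y)).symm
    (LinearMap.toContinuousLinearMap ℓ)), fun z => ?_⟩
  exact InnerProductSpace.toDual_symm_apply

variable [IsRiemannianManifold (𝓡 n) M]

open MeasureTheory in
/-- A function is locally Lipschitz about `y`, with a constant as close as one likes to the norm of
its gradient at `y`. -/
theorem eventually_sub_le_grad_mul_dist {w : M → ℝ} {y : M} (hw : ContMDiffAt (𝓡 n) 𝓘(ℝ) 1 w y)
    {η : ℝ} (hη : 0 < η) :
    ∀ᶠ q in 𝓝 y, |w q - w y| ≤ (‖grad n w y‖ + η) * dist y q := by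
  obtain ⟨ρ, hρ, hball⟩ := Metric.eventually_nhds_iff.1
    ((eventually_mvfderiv_le hw hη).and ((contMDiffAt_iff_contMDiffAt_nhds (by simp)).1 hw))
  refine Metric.eventually_nhds_iff.2 ⟨ρ / 2, by positivity, fun q hq => ?_⟩
  rw [dist_comm] at hq
  set K := ‖grad n w y‖ + η with hK
  have hKpos : 0 < K := by positivity
  refine le_of_forall_pos_lt_add fun ε hε => ?_
  -- The first bound keeps the path in the ball of radius `ρ`, where the differential is controlled;
  -- the second makes the excess length cost less than `ε`.
  set ε' := min (ρ / 2) (ε / (2 * K)) with hε'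
  have hε'pos : 0 < ε' := by positivity
  obtain ⟨γ, h0, h1, hs, hl⟩ := exists_path_pathELength_lt n (lt_add_of_pos_right (dist y q) hε'pos)
  have hγ : ∀ t ∈ Icc (0 : ℝ) 1, dist (γ t) y < ρ := fun t ht => by
    have h2 : edist (γ 0) (γ t) < ENNReal.ofReal (dist y q + ε') :=
      ((edist_le_pathELength hs ht.1).trans (Manifold.pathELength_mono le_rfl ht.2)).trans_lt hl
    rw [h0, edist_dist, ENNReal.ofReal_lt_ofReal_iff (by positivity)] at h2
    have := min_le_left (ρ / 2) (ε / (2 * K))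
    rw [dist_comm]
    linarith
  have hf : ContDiffOn ℝ 1 (w ∘ γ) (Icc 0 1) := fun t ht =>
    ((((hball (hγ t ht)).2).comp t hs.contMDiffAt).contDiffAt).contDiffWithinAt
  have h2 : ‖(w ∘ γ) 1 - (w ∘ γ) 0‖ₑ ≤ ENNReal.ofReal K * Manifold.pathELength (𝓡 n) γ 0 1 := by
    refine (enorm_sub_le_lintegral_derivWithin_Icc_of_contDiffOn_Icc hf zero_le_one).trans ?_
    rw [Manifold.pathELength_eq_lintegral_mfderiv_Icc, ← lintegral_const_mul' _ _ ENNReal.ofReal_ne_top]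
    refine setLIntegral_mono' measurableSet_Icc fun t ht => ?_
    have hwt : MDifferentiableAt (𝓡 n) 𝓘(ℝ) w (γ t) := (hball (hγ t ht)).2.mdifferentiableAt one_ne_zero
    have hγt : MDifferentiableAt 𝓘(ℝ) (𝓡 n) γ t := hs.contMDiffAt.mdifferentiableAt one_ne_zero
    have hd : DifferentiableAt ℝ (w ∘ γ) t := (hwt.comp t hγt).differentiableAt
    rw [hd.derivWithin (uniqueDiffOn_Icc zero_lt_one t ht)]
    have h3 : deriv (w ∘ γ) t = mvfderiv (𝓡 n) w (γ t) (mfderiv 𝓘(ℝ) (𝓡 n) γ t 1) := by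
      have := mfderiv_comp t hwt hγt
      rw [mfderiv_eq_fderiv] at this
      change fderiv ℝ (w ∘ γ) t 1 = _
      exact congrArg (fun L => L (1 : ℝ)) this
    rw [h3, Real.enorm_eq_ofReal_abs, ← ofReal_norm, ← ENNReal.ofReal_mul hKpos.le]
    exact ENNReal.ofReal_le_ofReal ((hball (hγ t ht)).1 _)
  have h3 : ‖(w ∘ γ) 1 - (w ∘ γ) 0‖ₑ < ENNReal.ofReal (K * (dist y q + ε')) := by
    refine h2.trans_lt ?_
    rw [ENNReal.ofReal_mul hKpos.le]
    exact (ENNReal.mul_lt_mul_iff_right (by simpa using hKpos) ENNReal.ofReal_ne_top).2 hl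
  rw [Function.comp_apply, Function.comp_apply, h0, h1, Real.enorm_eq_ofReal_abs,
    ENNReal.ofReal_lt_ofReal_iff (by positivity)] at h3
  have h4 : K * ε' ≤ ε / 2 := by
    calc K * ε' ≤ K * (ε / (2 * K)) := by gcongr; exact min_le_right _ _
      _ = ε / 2 := by field_simp
  linarith

set_option synthInstance.maxHeartbeats 200000 in
open MeasureTheory in
/-- The distance from `y` to the points of the parabola `c + s v - s² Γ(v, v) / 2`, in the preferred
chart at `y`, is `s |v|` up to an error of smaller order than `s²`. -/
theorem eventually_dist_parabola_le (y : M) {v b : EuclideanSpace ℝ (Fin n)}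
    (hv : tangentVec y v ≠ 0)
    (hb : ∀ z, inner ℝ (tangentVec y b) (tangentVec y z) = christoffel y v v z)
    {η : ℝ} (hη : 0 < η) :
    ∀ᶠ s : ℝ in 𝓝[>] 0, dist y ((extChartAt (𝓡 n) y).symm
      (extChartAt (𝓡 n) y y + s • v - (s ^ 2 / 2) • b)) ≤ s * (‖tangentVec y v‖ + η * s) := by
  obtain ⟨B, hB, hBg, hΓ⟩ := exists_chartMetric_christoffel (n := n) y
  set c := extChartAt (𝓡 n) y y with hc
  set σ : ℝ → EuclideanSpace ℝ (Fin n) := fun s => c + s • v - (s ^ 2 / 2) • b with hσ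
  have hσ0 : σ 0 = c := by simp [hσ]
  have hσd (s : ℝ) : HasDerivAt σ (v - s • b) s := by
    simpa [sub_eq_add_neg, hσ] using hasDerivAt_parabola c v (-b) s
  have hσc : ContDiff ℝ 1 σ := by fun_prop
  set N := ‖tangentVec y v‖ with hN
  have hNpos : 0 < N := norm_pos_iff.2 hv
  set G : ℝ → ℝ := fun t => B (σ t) (v - t • b) (v - t • b) with hG
  have hself (a e : EuclideanSpace ℝ (Fin n)) : B c a e = inner ℝ (tangentVec y a) (tangentVec y e) := by
    rw [← hBg c (mem_extChartAt_target y), hc, chartMetric_self]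
  have hG0 : G 0 = N ^ 2 := by simp [hG, hσ0, hself, hN]
  -- The squared speed is stationary at `0`: the derivative of the metric cancels `2⟨Γ(v, v), v⟩ =
  -- ∂_v g(v, v)`.
  have hGd : HasDerivAt G 0 0 := by
    have h1 := hasDerivAt_bilin_parabola hB v (-b)
    have h2 : tangentVec y (-b) = -tangentVec y b := rfl
    have h3 : inner ℝ (tangentVec y v) (tangentVec y b) = christoffel y v v v := by
      rw [real_inner_comm, hb]
    rw [hself, hself, h2, inner_neg_right, inner_neg_left, hb, h3, hΓ] at h1
    refine (h1.congr_deriv (by ring)).congr_of_eventuallyEq (Eventually.of_forall fun t => ?_)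
    simp [hG, hσ, sub_eq_add_neg]
  -- The constant is chosen so that `N² + 2Nηs ≤ (N + ηs)²`, which bounds the speed by `N + ηs`.
  have hGle : ∀ᶠ t in 𝓝 (0 : ℝ), |G t - N ^ 2| ≤ 2 * N * η * |t| := by
    have h1 := (hasDerivAt_iff_isLittleO.1 hGd).def (c := 2 * N * η) (by positivity)
    filter_upwards [h1] with t ht
    simpa [hG0] using ht
  have htarget : ∀ᶠ t in 𝓝 (0 : ℝ), σ t ∈ (extChartAt (𝓡 n) y).target :=
    hσc.continuous.continuousAt.eventually_mem (by rw [hσ0]; exact extChartAt_target_mem_nhds y)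
  obtain ⟨ρ, hρ, hball⟩ := Metric.eventually_nhds_iff.1 (hGle.and htarget)
  filter_upwards [Ioo_mem_nhdsGT hρ] with s hs
  have hIcc (t : ℝ) (ht : t ∈ Icc 0 s) := hball (y := t) (by
    rw [Real.dist_eq, sub_zero, abs_of_nonneg ht.1]; exact ht.2.trans_lt hs.2)
  set γ : ℝ → M := (extChartAt (𝓡 n) y).symm ∘ σ with hγ
  have hγs : ContMDiffOn 𝓘(ℝ) (𝓡 n) 1 γ (Icc 0 s) :=
    (contMDiffOn_extChartAt_symm y).comp hσc.contMDiff.contMDiffOn fun t ht => (hIcc t ht).2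
  have hlen : Manifold.riemannianEDist (𝓡 n) y (γ s) ≤ Manifold.pathELength (𝓡 n) γ 0 s :=
    Manifold.riemannianEDist_le_pathELength hγs (by simp [hγ, hσ0, hc]) rfl hs.1.le
  have hsp (t : ℝ) (ht : t ∈ Icc 0 s) :
      ‖mfderiv 𝓘(ℝ) (𝓡 n) γ t 1‖ₑ ≤ ENNReal.ofReal (N + η * s) := by
    have hσm : MDifferentiableAt 𝓘(ℝ) 𝓘(ℝ, EuclideanSpace ℝ (Fin n)) σ t :=
      (hσd t).differentiableAt.mdifferentiableAt
    have hsm : MDifferentiableAt 𝓘(ℝ, EuclideanSpace ℝ (Fin n)) (𝓡 n)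
        (extChartAt (𝓡 n) y).symm (σ t) :=
      ((contMDiffOn_extChartAt_symm (n := 1) y).contMDiffAt
        (extChartAt_target_mem_nhds' (hIcc t ht).2)).mdifferentiableAt one_ne_zero
    have h1 : mfderiv 𝓘(ℝ) (𝓡 n) γ t 1 = mfderiv 𝓘(ℝ, EuclideanSpace ℝ (Fin n)) (𝓡 n)
        (extChartAt (𝓡 n) y).symm (σ t) (v - t • b) := by
      have h2 := congrArg (fun L => L (1 : ℝ)) (mfderiv_comp t hsm hσm)
      rw [mfderiv_eq_fderiv] at h2
      refine h2.trans ?_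
      have h3 : fderiv ℝ σ t 1 = v - t • b := (hσd t).deriv
      exact congrArg (mfderiv 𝓘(ℝ, EuclideanSpace ℝ (Fin n)) (𝓡 n)
        (extChartAt (𝓡 n) y).symm (σ t)) h3
    have h4 : ‖mfderiv 𝓘(ℝ) (𝓡 n) γ t 1‖ ^ 2 = G t := by
      rw [h1, ← real_inner_self_eq_norm_sq]
      exact hBg (σ t) (hIcc t ht).2 _ _
    rw [← ofReal_norm]
    refine ENNReal.ofReal_le_ofReal (abs_le_of_sq_le_sq' ?_ (by have := hs.1; positivity)).2
    rw [h4]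
    have h5 := (abs_le.1 (hIcc t ht).1).2
    rw [abs_of_nonneg ht.1] at h5
    have h6 : 2 * N * η * t ≤ 2 * N * η * s := by gcongr; exact ht.2
    nlinarith [sq_nonneg (η * s)]
  have hlen2 : Manifold.pathELength (𝓡 n) γ 0 s ≤ ENNReal.ofReal (s * (N + η * s)) := by
    rw [Manifold.pathELength_eq_lintegral_mfderiv_Icc]
    refine (setLIntegral_mono' measurableSet_Icc hsp).trans ?_
    rw [setLIntegral_const, Real.volume_Icc, sub_zero, mul_comm,
      ENNReal.ofReal_mul hs.1.le]
  have h7 : edist y (γ s) ≤ ENNReal.ofReal (s * (N + η * s)) := by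
    rw [IsRiemannianManifold.out (I := 𝓡 n)]
    exact hlen.trans hlen2
  rw [edist_dist] at h7
  exact (ENNReal.ofReal_le_ofReal_iff (by have := hs.1; positivity)).1 h7

end Curves

end

end JangPerron
namespace JangPerron

noncomputable section

variable {n : ℕ} {M : Type*}

/-! ### Second order conditions at a contact point -/

section NormedSpace

variable {V : Type*} [NormedAddCommGroup V] [NormedSpace ℝ V]

theorem nonneg_of_eventually_nonneg_mul_add {A m : ℝ}
    (h : ∀ᶠ s : ℝ in 𝓝[>] 0, 0 ≤ A + s * m) : 0 ≤ A := by
  have ht : Tendsto (fun s : ℝ => A + s * m) (𝓝[>] 0) (𝓝 (A + 0 * m)) :=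
    ((continuous_const.add (continuous_id.mul continuous_const)).tendsto 0).mono_left
      nhdsWithin_le_nhds
  simpa using ge_of_tendsto ht h

theorem continuousAt_parabola (c v b : V) :
    Tendsto (fun s : ℝ => c + s • v + (s ^ 2 / 2) • b) (𝓝[>] 0) (𝓝 c) := by
  have h := (hasDerivAt_parabola c v b 0).continuousAt.tendsto
  simp only [zero_smul, add_zero, ne_eq, OfNat.ofNat_ne_zero, not_false_eq_true, zero_pow,
    zero_div] at h
  exact h.mono_left nhdsWithin_le_nhds

/-- Second order Lagrange multiplier rule for a minimum of `F` on the half space `{0 ≤ G}`. -/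
theorem exists_multiplier {F G : V → ℝ} {c : V} (hF : ContDiffAt ℝ 2 F c)
    (hG : ContDiffAt ℝ 2 G c) (hGc : G c = 0) (hG' : fderiv ℝ G c ≠ 0)
    (h : ∀ᶠ u in 𝓝 c, 0 ≤ G u → F c ≤ F u) :
    ∃ l : ℝ, 0 ≤ l ∧ (∀ v, fderiv ℝ F c v = l * fderiv ℝ G c v) ∧
      ∀ v, fderiv ℝ G c v = 0 →
        l * fderiv ℝ (fderiv ℝ G) c v v ≤ fderiv ℝ (fderiv ℝ F) c v v := by
  have key (v b : V) (ε : ℝ) (hε : 0 < ε) (hpos : ∀ᶠ s : ℝ in 𝓝[>] 0,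
      0 ≤ s * fderiv ℝ G c v + s ^ 2 / 2 * (fderiv ℝ (fderiv ℝ G) c v v + fderiv ℝ G c b)
        - ε * s ^ 2) :
      ∀ᶠ s : ℝ in 𝓝[>] 0, 0 ≤ s * fderiv ℝ F c v
        + s ^ 2 / 2 * (fderiv ℝ (fderiv ℝ F) c v v + fderiv ℝ F c b) + ε * s ^ 2 := by
    filter_upwards [(continuousAt_parabola c v b).eventually h, hpos,
      nhdsWithin_le_nhds (eventually_abs_parabola_le hF v b hε),
      nhdsWithin_le_nhds (eventually_abs_parabola_le hG v b hε)] with s h1 h2 h3 h4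
    rw [hGc] at h4
    have h5 := h1 (by linarith [(abs_le.1 h4).1])
    linarith [(abs_le.1 h3).2]
  -- A straight line with this velocity enters the half space, whatever the second derivative of
  -- `G`.
  have hfirst (v : V) (hv : 0 < fderiv ℝ G c v) : 0 ≤ fderiv ℝ F c v := by
    have h1 := key v 0 1 one_pos (by
      have h2 : ∀ᶠ s : ℝ in 𝓝 0, 0 < fderiv ℝ G c v
          + s * ((fderiv ℝ (fderiv ℝ G) c v v + fderiv ℝ G c 0) / 2 - 1) := by
        refine (Continuous.tendsto (by fun_prop) 0).eventually_const_lt ?_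
        simpa using hv
      filter_upwards [nhdsWithin_le_nhds h2, self_mem_nhdsWithin] with s hs hs0
      have := mul_pos (mem_Ioi.1 hs0) hs
      nlinarith)
    refine nonneg_of_eventually_nonneg_mul_add
      (m := (fderiv ℝ (fderiv ℝ F) c v v + fderiv ℝ F c 0) / 2 + 1) ?_
    filter_upwards [h1, self_mem_nhdsWithin] with s hs hs0
    refine nonneg_of_mul_nonneg_right (a := s) ?_ hs0
    nlinarith
  obtain ⟨e₀, he₀⟩ : ∃ e, fderiv ℝ G c e ≠ 0 := by
    by_contra! hcon
    exact hG' (ContinuousLinearMap.ext hcon)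
  set e : V := (fderiv ℝ G c e₀)⁻¹ • e₀ with he
  have he1 : fderiv ℝ G c e = 1 := by simp [he, he₀]
  set l := fderiv ℝ F c e with hl
  have hl0 : 0 ≤ l := hfirst e (by rw [he1]; exact one_pos)
  have hge (v : V) : l * fderiv ℝ G c v ≤ fderiv ℝ F c v := by
    refine le_of_forall_pos_le_add fun ε hε => ?_
    -- The tangential part of `v` is tilted slightly inwards, to make the derivative of `G` strictly
    -- positive.
    have h1 := hfirst (v - (fderiv ℝ G c v) • e + (ε / (l + 1)) • e) (by
      simp only [map_add, map_sub, map_smul, he1, smul_eq_mul]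
      ring_nf
      positivity)
    simp only [map_add, map_sub, map_smul, smul_eq_mul] at h1
    rw [← hl] at h1
    have h2 : ε / (l + 1) * l ≤ ε := by
      rw [div_mul_eq_mul_div, div_le_iff₀ (by positivity)]
      nlinarith
    linarith
  refine ⟨l, hl0, fun v => le_antisymm ?_ (hge v), fun v hv => ?_⟩
  · have := hge (-v)
    simp only [map_neg] at this
    linarith
  · have hFv : fderiv ℝ F c v = 0 := by
      have h1 := hge v
      have h2 := hge (-v)
      simp only [map_neg, hv] at h1 h2
      linarith
    refine le_of_forall_pos_le_add fun ε hε => ?_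
    set θ := ε / (l + 1) / 2 with hθ
    have hθ0 : 0 < θ := by positivity
    have hθl : 2 * θ * (l + 1) = ε := by rw [hθ]; field_simp
    -- The acceleration bends the curve so that the second derivative of `G` along it is `2θ`,
    -- exactly absorbing the Taylor error `θ s²`.
    have h1 := key v ((2 * θ - fderiv ℝ (fderiv ℝ G) c v v) • e) θ hθ0 (by
      refine Eventually.of_forall fun s => ?_
      simp only [map_smul, he1, hv, smul_eq_mul]
      ring_nf
      exact le_rfl)
    obtain ⟨s, hs, hs0⟩ := (h1.and self_mem_nhdsWithin).exists
    have hs0' : (0 : ℝ) < s := hs0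
    simp only [map_smul, smul_eq_mul, hFv, mul_zero, zero_add] at hs
    rw [← hl] at hs
    have h2 : 0 ≤ s ^ 2 / 2 * (fderiv ℝ (fderiv ℝ F) c v v
      + (2 * θ - fderiv ℝ (fderiv ℝ G) c v v) * l + 2 * θ) := by linarith
    have h3 := nonneg_of_mul_nonneg_right h2 (by positivity)
    linarith

theorem fderiv_fderiv_nonneg_of_isLocalMin {F : V → ℝ} {c : V} (hF : ContDiffAt ℝ 2 F c)
    (h : IsLocalMin F c) (v : V) : 0 ≤ fderiv ℝ (fderiv ℝ F) c v v := by
  refine le_of_forall_pos_le_add fun ε hε => ?_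
  have h1 : ∀ᶠ s : ℝ in 𝓝[>] 0, 0 < s ∧ 0 ≤ s ^ 2 / 2 * (fderiv ℝ (fderiv ℝ F) c v v + ε) := by
    filter_upwards [(continuousAt_parabola c v 0).eventually h, self_mem_nhdsWithin,
      nhdsWithin_le_nhds (eventually_abs_parabola_le hF v 0 (half_pos hε))] with s h1 h2 h3
    rw [h.fderiv_eq_zero] at h3
    refine ⟨h2, ?_⟩
    simp only [zero_apply, mul_zero, sub_zero, add_zero] at h3
    have := (abs_le.1 h3).2
    simp only [smul_zero, add_zero] at this h1
    linarith
  obtain ⟨s, hs0, hs⟩ := h1.exists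
  exact nonneg_of_mul_nonneg_right hs (by positivity)

/-- The trace of a bilinear form dominates its value on a unit vector, if it is nonnegative on the
orthogonal complement of this vector. -/
theorem le_trace_of_nonneg_on_orthogonal {T ι : Type*} [NormedAddCommGroup T]
    [InnerProductSpace ℝ T] [Fintype ι] (e : OrthonormalBasis ι ℝ T) (B : T →ₗ[ℝ] T →ₗ[ℝ] ℝ)
    {ν : T} (hν : ‖ν‖ = 1) (h : ∀ v, inner ℝ ν v = 0 → 0 ≤ B v v) :
    B ν ν ≤ ∑ i, B (e i) (e i) := by
  have hνν : inner ℝ ν ν = (1 : ℝ) := by rw [real_inner_self_eq_norm_sq, hν, one_pow]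
  -- Summing `B` over the projections of the basis to the orthogonal complement of `ν` gives `tr B -
  -- B(ν, ν)`.
  have h1 (i : ι) : 0 ≤ B (e i - inner ℝ (e i) ν • ν) (e i - inner ℝ (e i) ν • ν) := by
    refine h _ ?_
    rw [inner_sub_right, inner_smul_right, hνν, real_inner_comm]
    ring
  have h2 := Finset.sum_nonneg fun i (_ : i ∈ Finset.univ) => h1 i
  have h3 : ∑ i, inner ℝ (e i) ν • e i = ν := e.sum_repr' ν
  have h4 : ∑ i, B (e i) (inner ℝ (e i) ν • ν) = B ν ν := by
    simpa only [map_sum, map_smul, LinearMap.sum_apply, LinearMap.smul_apply] using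
      congrArg (fun x => B x ν) h3
  have h5 : ∑ i, B (inner ℝ (e i) ν • ν) (e i) = B ν ν := by
    simpa only [map_sum, map_smul, LinearMap.sum_apply, LinearMap.smul_apply] using
      congrArg (B ν) h3
  have h6 : ∑ i, B (inner ℝ (e i) ν • ν) (inner ℝ (e i) ν • ν) = B ν ν := by
    simp only [map_smul, LinearMap.smul_apply, smul_eq_mul, ← mul_assoc]
    rw [← Finset.sum_mul]
    have : ∑ i, inner ℝ (e i) ν * inner ℝ (e i) ν = (1 : ℝ) := by
      rw [← hνν, ← e.sum_inner_mul_inner ν ν]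
      exact Finset.sum_congr rfl fun i _ => by rw [real_inner_comm]
    rw [this, one_mul]
  simp only [map_sub, LinearMap.sub_apply, Finset.sum_sub_distrib] at h2
  rw [h4, h5, h6] at h2
  linarith

end NormedSpace

/-! ### Contact of a `C²` function with a hypersurface and with a distance function -/

section Touching

variable [MetricSpace M] [ChartedSpace (EuclideanSpace ℝ (Fin n)) M]

theorem tendsto_symm_parabola (y : M) (v b : EuclideanSpace ℝ (Fin n)) :
    Tendsto (fun s : ℝ => (extChartAt (𝓡 n) y).symm (extChartAt (𝓡 n) y y + s • v + (s ^ 2 / 2) • b))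
      (𝓝[>] 0) (𝓝 y) := by
  have h := (continuousAt_extChartAt_symm (I := 𝓡 n) y).tendsto
  rw [extChartAt_to_inv] at h
  exact h.comp (continuousAt_parabola _ v b)

variable [RiemannianBundle (fun x : M => TangentSpace (𝓡 n) x)]

/-- The bilinear form of second derivatives, in the preferred chart at `y`, as a form on the tangent
space. -/
def chartHess (u : M → ℝ) (y : M) : TangentSpace (𝓡 n) y →ₗ[ℝ] TangentSpace (𝓡 n) y →ₗ[ℝ] ℝ :=
  LinearMap.mk₂ ℝ (fun v w => fderiv ℝ (fderiv ℝ (u ∘ (extChartAt (𝓡 n) y).symm))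
      (extChartAt (𝓡 n) y y) (coordVec y v) (coordVec y w))
    (fun a b e => congrArg (fun L => L (coordVec y e)) (map_add (fderiv ℝ (fderiv ℝ
      (u ∘ (extChartAt (𝓡 n) y).symm)) (extChartAt (𝓡 n) y y)) (coordVec y a) (coordVec y b)))
    (fun r a e => congrArg (fun L => L (coordVec y e)) (map_smul (fderiv ℝ (fderiv ℝ
      (u ∘ (extChartAt (𝓡 n) y).symm)) (extChartAt (𝓡 n) y y)) r (coordVec y a)))
    (fun a b e => map_add (fderiv ℝ (fderiv ℝ (u ∘ (extChartAt (𝓡 n) y).symm))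
      (extChartAt (𝓡 n) y y) (coordVec y a)) (coordVec y b) (coordVec y e))
    (fun r a e => map_smul (fderiv ℝ (fderiv ℝ (u ∘ (extChartAt (𝓡 n) y).symm))
      (extChartAt (𝓡 n) y y) (coordVec y a)) r (coordVec y e))

theorem hess_eq_chartHess (u : M → ℝ) (y : M) (v w : TangentSpace (𝓡 n) y) :
    hess n u y v w = chartHess u y v w
      - christoffel y (coordVec y v) (coordVec y w) (coordVec y (grad n u y)) := rfl

variable [IsManifold (𝓡 n) ∞ M]
  [IsContMDiffRiemannianBundle (𝓡 n) ∞ (EuclideanSpace ℝ (Fin n))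
    (fun x : M => TangentSpace (𝓡 n) x)]

set_option synthInstance.maxHeartbeats 200000 in
theorem christoffel_smul_smul (y : M) (r : ℝ) (v w z : EuclideanSpace ℝ (Fin n)) :
    christoffel y (r • v) (r • w) z = r ^ 2 * christoffel y v w z := by
  obtain ⟨B, -, -, hΓ⟩ := exists_chartMetric_christoffel (n := n) y
  simp only [hΓ, map_smul, smul_apply, smul_eq_mul]
  ring

set_option synthInstance.maxHeartbeats 200000 in
theorem christoffel_smul_right (y : M) (r : ℝ) (v w z : EuclideanSpace ℝ (Fin n)) :
    christoffel y v w (r • z) = r * christoffel y v w z := by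
  obtain ⟨B, -, -, hΓ⟩ := exists_chartMetric_christoffel (n := n) y
  simp only [hΓ, map_smul, smul_apply, smul_eq_mul]
  ring

theorem hess_smul_smul (w : M → ℝ) (y : M) (r : ℝ) (v : TangentSpace (𝓡 n) y) :
    hess n w y (r • v) (r • v) = r ^ 2 * hess n w y v v := by
  have h : coordVec y (r • v) = r • coordVec y v := rfl
  simp only [hess, h, christoffel_smul_smul, map_smul, smul_apply, smul_eq_mul]
  ring

/-- Comparison of the level sets through `y` of two functions, when the one of `w` lies on the side
`{φ ≤ 0}` of the one of `φ`. -/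
theorem levelMC_le_levelMC
    (p : ∀ x : M, TangentSpace (𝓡 n) x →L[ℝ] TangentSpace (𝓡 n) x →L[ℝ] ℝ)
    {w φ : M → ℝ} {y : M} (hw : ContMDiffAt (𝓡 n) 𝓘(ℝ) 2 w y)
    (hφ : ContMDiffAt (𝓡 n) 𝓘(ℝ) 2 φ y) (hφy : φ y = 0) (hφ' : mvfderiv (𝓡 n) φ y ≠ 0)
    (hw' : grad n w y ≠ 0) (h : ∀ᶠ q in 𝓝 y, 0 ≤ φ q → w y ≤ w q) :
    levelMC n φ y ≤ levelMC n w y ∧ levelTrace p φ y = levelTrace p w y := by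
  have hmw : MDifferentiableAt (𝓡 n) 𝓘(ℝ) w y := hw.mdifferentiableAt two_ne_zero
  have hmφ : MDifferentiableAt (𝓡 n) 𝓘(ℝ) φ y := hφ.mdifferentiableAt two_ne_zero
  have hgφ : grad n φ y ≠ 0 := by
    rw [grad]
    simpa using hφ'
  have hΦ' : fderiv ℝ (φ ∘ (extChartAt (𝓡 n) y).symm) (extChartAt (𝓡 n) y y) ≠ 0 := fun h0 => by
    have := fderiv_eq_inner_grad y hmφ (coordVec y (grad n φ y))
    rw [h0] at this
    exact hgφ (inner_self_eq_zero.1 this.symm)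
  have hcont := (continuousAt_extChartAt_symm (I := 𝓡 n) y).tendsto
  rw [extChartAt_to_inv] at hcont
  obtain ⟨l, hl0, hl1, hl2⟩ := exists_multiplier (ContMDiffAt.contDiffAt_chart hw)
    (ContMDiffAt.contDiffAt_chart hφ) (by simp [hφy]) hΦ' (by
      filter_upwards [hcont.eventually h] with u hu
      simpa using hu)
  have hgrad : grad n w y = l • grad n φ y := by
    refine ext_inner_right ℝ fun v => ?_
    have := hl1 (coordVec y v)
    rw [fderiv_eq_inner_grad y hmw, fderiv_eq_inner_grad y hmφ] at this
    rw [inner_smul_left]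
    exact this
  have hl : 0 < l := hl0.lt_of_ne fun h0 => hw' (by rw [hgrad, ← h0, zero_smul])
  -- As `Dw = l Dφ`, the Christoffel terms of `D²w` and `l D²φ` agree, so `B` is the difference of
  -- the covariant Hessians. By the multiplier rule it is nonnegative on the tangent space of the
  -- level set.
  set B := chartHess (n := n) w y - l • chartHess (n := n) φ y with hB
  have hhess (v e : TangentSpace (𝓡 n) y) : hess n w y v e = l * hess n φ y v e + B v e := by
    have h1 : coordVec y (l • grad n φ y) = l • coordVec y (grad n φ y) := rfl
    rw [hess_eq_chartHess, hess_eq_chartHess, hgrad, h1, christoffel_smul_right, hB]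
    simp only [LinearMap.sub_apply, LinearMap.smul_apply, smul_eq_mul]
    ring
  set g := grad n φ y with hg
  have hgn : 0 < ‖g‖ := norm_pos_iff.2 hgφ
  have htrace := le_trace_of_nonneg_on_orthogonal (stdOrthonormalBasis ℝ (TangentSpace (𝓡 n) y)) B
    (ν := ‖g‖⁻¹ • g) (by rw [norm_smul, norm_inv, norm_norm, inv_mul_cancel₀ hgn.ne']) fun v hv => by
      rw [inner_smul_left] at hv
      have h1 : inner ℝ g v = 0 := by simpa [hgn.ne'] using hv
      have h2 := hl2 (coordVec y v) (by rw [fderiv_eq_inner_grad y hmφ]; exact h1)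
      exact sub_nonneg.2 h2
  simp only [map_smul, LinearMap.smul_apply, smul_eq_mul] at htrace
  have hsum : metricTrace y (hess n w y) = l * metricTrace y (hess n φ y)
      + ∑ i, B (stdOrthonormalBasis ℝ (TangentSpace (𝓡 n) y) i)
        (stdOrthonormalBasis ℝ (TangentSpace (𝓡 n) y) i) := by
    simp only [metricTrace, hhess, Finset.sum_add_distrib, Finset.mul_sum]
  constructor
  · rw [levelMC, levelMC, hgrad, hess_smul_smul, hhess, hsum, norm_smul, Real.norm_of_nonneg hl0]
    set X := ∑ i, B (stdOrthonormalBasis ℝ (TangentSpace (𝓡 n) y) i)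
        (stdOrthonormalBasis ℝ (TangentSpace (𝓡 n) y) i) with hX
    -- The difference of the two mean curvatures is `(tr B - B(ν, ν)) / |Dw|` with `ν = g / |g|`.
    have h1 : (l * metricTrace y (hess n φ y) + X - l ^ 2 * (l * hess n φ y g g + B g g)
        / (l * ‖g‖) ^ 2) / (l * ‖g‖)
        = (metricTrace y (hess n φ y) - hess n φ y g g / ‖g‖ ^ 2) / ‖g‖
          + (X - ‖g‖⁻¹ * (‖g‖⁻¹ * B g g)) / (l * ‖g‖) := by
      field_simp
      ring
    rw [h1]
    have : 0 ≤ (X - ‖g‖⁻¹ * (‖g‖⁻¹ * B g g)) / (l * ‖g‖) :=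
      div_nonneg (sub_nonneg.2 htrace) (by positivity)
    linarith
  · have h1 : p y (l • g) (l • g) = l * (l * p y g g) := by
      simp only [map_smul, smul_apply, smul_eq_mul]
    rw [levelTrace, levelTrace, hgrad, h1, norm_smul, Real.norm_of_nonneg hl0, ← hg]
    field_simp

variable [IsRiemannianManifold (𝓡 n) M]

/-- If `w + a dist(·, S)` has a local minimum at `y ∉ S`, then `|Dw| = a` and `D²w(Dw, Dw) ≥ 0`
at `y`. -/
theorem norm_grad_eq_and_hess_nonneg {w : M → ℝ} {y : M} (hw : ContMDiffAt (𝓡 n) 𝓘(ℝ) 2 w y)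
    {a : ℝ} (ha : 0 < a) {S : Set M} (hS : S.Nonempty) (hy : 0 < Metric.infDist y S)
    (h : ∀ᶠ q in 𝓝 y, a * (Metric.infDist y S - Metric.infDist q S) ≤ w q - w y) :
    ‖grad n w y‖ = a ∧ 0 ≤ hess n w y (grad n w y) (grad n w y) := by
  have hmd : MDifferentiableAt (𝓡 n) 𝓘(ℝ) w y := hw.mdifferentiableAt two_ne_zero
  set g := grad n w y with hg
  -- Along the parabola with acceleration `-Γ(v, v)`, the distance to `S` grows by at most `s|v| +
  -- o(s²)`, while the second order term of `w` is the covariant Hessian. The inequality is divided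
  -- by `s`.
  have key (v : TangentSpace (𝓡 n) y) (hv : v ≠ 0) (η : ℝ) (hη : 0 < η) : ∀ᶠ s : ℝ in 𝓝[>] 0,
      0 ≤ inner ℝ g v + a * ‖v‖ + s * (hess n w y v v / 2 + η) := by
    obtain ⟨b, hb⟩ := exists_inner_eq_christoffel (n := n) y (coordVec y v)
    set η' := η / (a + 1) with hη'
    have hη'0 : 0 < η' := by positivity
    have hη'a : η' * (a + 1) = η := by rw [hη']; field_simp
    filter_upwards [(tendsto_symm_parabola y (coordVec y v) (-b)).eventually h,
      eventually_dist_parabola_le y (v := coordVec y v) hv hb hη'0, self_mem_nhdsWithin,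
      nhdsWithin_le_nhds (eventually_abs_parabola_le (ContMDiffAt.contDiffAt_chart hw)
        (coordVec y v) (-b) hη'0)] with s h1 h2 h3 h4
    have hs : (0 : ℝ) < s := h3
    simp only [smul_neg, ← sub_eq_add_neg, fderiv_eq_inner_grad y hmd, ← hg] at h1 h4
    have h5 : inner ℝ g (tangentVec y (-b))
        = -christoffel y (coordVec y v) (coordVec y v) (coordVec y g) := by
      rw [← hb, real_inner_comm, ← inner_neg_left]
      rfl
    rw [h5, ← sub_eq_add_neg] at h4
    have h6 : hess n w y v v = fderiv ℝ (fderiv ℝ (w ∘ (extChartAt (𝓡 n) y).symm))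
        (extChartAt (𝓡 n) y y) (coordVec y v) (coordVec y v)
        - christoffel y (coordVec y v) (coordVec y v) (coordVec y g) := rfl
    rw [← h6] at h4
    simp only [Function.comp_apply, extChartAt_to_inv] at h4
    set q := (extChartAt (𝓡 n) y).symm
      (extChartAt (𝓡 n) y y + s • coordVec y v - (s ^ 2 / 2) • b) with hq
    have h7 : Metric.infDist q S ≤ Metric.infDist y S + dist y q := by
      rw [dist_comm]
      exact Metric.infDist_le_infDist_add_dist
    have h8 := (abs_le.1 h4).2
    have h9 : tangentVec y (coordVec y v) = v := rfl
    rw [h9] at h2 h8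
    have h10 : a * dist y q ≤ a * (s * (‖v‖ + η' * s)) := by gcongr
    refine nonneg_of_mul_nonneg_right (a := s) ?_ hs
    nlinarith
  have hle : ‖g‖ ≤ a := by
    rcases eq_or_ne g 0 with h0 | h0
    · rw [h0, norm_zero]; exact ha.le
    have h1 := nonneg_of_eventually_nonneg_mul_add (key (-g) (neg_ne_zero.2 h0) 1 one_pos)
    rw [inner_neg_right, real_inner_self_eq_norm_sq, norm_neg] at h1
    have h2 : 0 < ‖g‖ := norm_pos_iff.2 h0
    nlinarith
  -- A step of length `s` towards an almost nearest point of `S` lowers the distance by at least `s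
  -- - 2s²`, so `w` rises by at least `a(s - 2s²)`.
  have hge : a ≤ ‖g‖ := by
    refine le_of_forall_pos_le_add fun η hη => ?_
    obtain ⟨ρ, hρ, hball⟩ := Metric.eventually_nhds_iff.1
      ((eventually_sub_le_grad_mul_dist (hw.of_le one_le_two) hη).and h)
    have h1 : ∀ᶠ s : ℝ in 𝓝[>] 0, 0 ≤ (‖g‖ + η - a) + s * (2 * a) := by
      filter_upwards [Ioo_mem_nhdsGT (lt_min hρ hy)] with s hs
      obtain ⟨z, hz, hyz⟩ := (Metric.infDist_lt_iff hS).1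
        (lt_add_of_pos_right (Metric.infDist y S) (by have := hs.1; positivity : 0 < s ^ 2))
      have hsD : s ≤ dist y z :=
        (hs.2.le.trans (min_le_right _ _)).trans (Metric.infDist_le_dist_of_mem hz)
      obtain ⟨q, hq1, hq2⟩ := exists_intermediate_point n y z (s := s) (η := s ^ 2)
        ⟨hs.1.le, hsD⟩ (by have := hs.1; positivity)
      obtain ⟨h2, h3⟩ := hball (y := q) (by
        rw [dist_comm, hq1]; exact hs.2.trans_le (min_le_left _ _))
      rw [hq1, ← hg] at h2
      have h4 : Metric.infDist q S ≤ dist q z := Metric.infDist_le_dist_of_mem hz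
      have h5 : a * (s - 2 * s ^ 2) ≤ a * (Metric.infDist y S - Metric.infDist q S) :=
        mul_le_mul_of_nonneg_left (by linarith) ha.le
      refine nonneg_of_mul_nonneg_right (a := s) ?_ hs.1
      have := (abs_le.1 h2).2
      nlinarith
    have := nonneg_of_eventually_nonneg_mul_add h1
    linarith
  have heq : ‖g‖ = a := le_antisymm hle hge
  refine ⟨heq, le_of_forall_pos_le_add fun η hη => ?_⟩
  have h0 : g ≠ 0 := by
    rw [← norm_pos_iff, heq]
    exact ha
  -- For `v = -g` with `|g| = a` the first order term `-|g|² + a|g|` vanishes and only the Hessian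
  -- remains.
  obtain ⟨s, h1, hs⟩ := ((key (-g) (neg_ne_zero.2 h0) (η / 2) (half_pos hη)).and
    self_mem_nhdsWithin).exists
  have h2 : hess n w y (-g) (-g) = hess n w y g g := by
    simpa using hess_smul_smul w y (-1) g
  rw [inner_neg_right, real_inner_self_eq_norm_sq, norm_neg, heq, h2] at h1
  have h3 : 0 ≤ s * ((hess n w y g g + η) / 2) := by linarith
  have h4 := nonneg_of_mul_nonneg_right h3 hs
  linarith

end Touching

end

end JangPerron
namespace JangPerron

noncomputable section

variable {n : ℕ} {M : Type*}

/-! ### The Jang operator at a contact point -/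

section Jang

variable [MetricSpace M] [ChartedSpace (EuclideanSpace ℝ (Fin n)) M]
  [RiemannianBundle (fun x : M => TangentSpace (𝓡 n) x)]

theorem abs_metricTrace_le {x : M} {B : TangentSpace (𝓡 n) x → TangentSpace (𝓡 n) x → ℝ} {P : ℝ}
    (hB : ∀ v, |B v v| ≤ P * ‖v‖ ^ 2) : |metricTrace x B| ≤ n * P := by
  refine (Finset.abs_sum_le_sum_abs _ _).trans ?_
  have h : Module.finrank ℝ (TangentSpace (𝓡 n) x) = n :=
    finrank_euclideanSpace_fin (𝕜 := ℝ) (n := n)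
  refine (Finset.sum_le_sum (g := fun _ => P) fun i _ => ?_).trans_eq ?_
  · have := hB (stdOrthonormalBasis ℝ (TangentSpace (𝓡 n) x) i)
    rwa [OrthonormalBasis.norm_eq_one, one_pow, mul_one] at this
  · rw [Finset.sum_const, Finset.card_univ, Fintype.card_fin, h, nsmul_eq_mul]

theorem abs_levelTrace_le
    {p : ∀ x : M, TangentSpace (𝓡 n) x →L[ℝ] TangentSpace (𝓡 n) x →L[ℝ] ℝ} {y : M} {P : ℝ}
    (hP : ∀ v, |p y v v| ≤ P * ‖v‖ ^ 2) {w : M → ℝ} (hw : grad n w y ≠ 0) :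
    |levelTrace p w y| ≤ (n + 1) * P := by
  have h1 := abs_metricTrace_le (B := fun v w => p y v w) hP
  have h2 : |p y (grad n w y) (grad n w y) / ‖grad n w y‖ ^ 2| ≤ P := by
    have : 0 < ‖grad n w y‖ ^ 2 := by positivity
    rw [abs_div, abs_of_pos this, div_le_iff₀ this]
    exact hP _
  refine (abs_sub _ _).trans ?_
  linarith

/-- A lower bound for the Jang operator at a point with non-negative Hessian in the direction of
the gradient, in terms of the level set. -/
theorem le_graphMC_add_graphTrace
    {p : ∀ x : M, TangentSpace (𝓡 n) x →L[ℝ] TangentSpace (𝓡 n) x →L[ℝ] ℝ} {y : M} {P a χ : ℝ}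
    (hP : ∀ v, |p y v v| ≤ P * ‖v‖ ^ 2) {w : M → ℝ} (ha : 0 < a) (hw : ‖grad n w y‖ = a)
    (hh : 0 ≤ hess n w y (grad n w y) (grad n w y))
    (hχ : χ ≤ levelMC n w y + levelTrace p w y) :
    χ * (a / √(1 + a ^ 2)) - (1 - a / √(1 + a ^ 2)) * ((n + 1) * P) - P / (1 + a ^ 2)
      ≤ graphMC n w y + graphTrace p w y := by
  have hs : 0 < √(1 + a ^ 2) := Real.sqrt_pos.2 (by positivity)
  have hg : grad n w y ≠ 0 := by
    rw [← norm_pos_iff, hw]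
    exact ha
  set Λ := a / √(1 + a ^ 2) with hΛ
  have hΛ0 : 0 < Λ := div_pos ha hs
  have hΛ1 : Λ ≤ 1 := by
    rw [hΛ, div_le_one hs]
    exact Real.le_sqrt_of_sq_le (by linarith)
  -- The two sides differ only in dividing `D²w(Dw, Dw) ≥ 0` by `a²` or by `1 + a²`.
  have hH : Λ * levelMC n w y ≤ graphMC n w y := by
    rw [levelMC, graphMC, hw, hΛ, div_mul_div_comm, mul_comm (√(1 + a ^ 2)), mul_div_mul_left _ _
      ha.ne']
    have : hess n w y (grad n w y) (grad n w y) / (1 + a ^ 2)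
        ≤ hess n w y (grad n w y) (grad n w y) / a ^ 2 :=
      div_le_div_of_nonneg_left hh (by positivity) (by linarith)
    exact div_le_div_of_nonneg_right (by linarith) hs.le
  -- The traces differ by `p(ν, ν) / (1 + a²)`, where `ν = Dw / a`.
  have hT : levelTrace p w y - P / (1 + a ^ 2) ≤ graphTrace p w y := by
    rw [levelTrace, graphTrace, hw]
    have h1 : p y (grad n w y) (grad n w y) / (1 + a ^ 2)
        = p y (grad n w y) (grad n w y) / a ^ 2
          - p y (grad n w y) (grad n w y) / a ^ 2 / (1 + a ^ 2) := by
      field_simp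
      ring
    have h2 : -P ≤ p y (grad n w y) (grad n w y) / a ^ 2 := by
      rw [le_div_iff₀ (by positivity), ← hw]
      linarith [(abs_le.1 (hP (grad n w y))).1]
    have h3 := div_le_div_of_nonneg_right h2 (by positivity : (0 : ℝ) ≤ 1 + a ^ 2)
    rw [neg_div] at h3
    linarith
  -- With `H` and `τ` the mean curvature and trace of the level set, `ΛH + τ = Λ(H + τ) + (1 - Λ)τ`.
  have hτ := (abs_le.1 (abs_levelTrace_le hP hg)).1
  have h4 := mul_le_mul_of_nonneg_left hχ hΛ0.le
  have h5 := mul_le_mul_of_nonneg_left hτ (sub_nonneg.2 hΛ1)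
  linarith

/-- The right side tends to `2χ`: the factor `2` in the assumption on the distance surfaces is the
room that absorbs the errors. -/
theorem eventually_lt_slope_bound {χ : ℝ} (hχ : 0 < χ) (K P : ℝ) :
    ∀ᶠ a : ℝ in atTop,
      χ < 2 * χ * (a / √(1 + a ^ 2)) - (1 - a / √(1 + a ^ 2)) * K - P / (1 + a ^ 2) := by
  have h1 : Tendsto (fun a : ℝ => 1 + a ^ 2) atTop atTop :=
    tendsto_atTop_add_const_left _ _ (tendsto_pow_atTop two_ne_zero)
  have h2 : Tendsto (fun a : ℝ => a / √(1 + a ^ 2)) atTop (𝓝 1) := by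
    have h3 : Tendsto (fun a : ℝ => √(1 - (1 + a ^ 2)⁻¹)) atTop (𝓝 √(1 - 0)) :=
      (Real.continuous_sqrt.tendsto _).comp (tendsto_const_nhds.sub h1.inv_tendsto_atTop)
    rw [sub_zero, Real.sqrt_one] at h3
    refine h3.congr' ?_
    filter_upwards [eventually_ge_atTop 0] with a ha
    have : 1 - (1 + a ^ 2)⁻¹ = a ^ 2 / (1 + a ^ 2) := by
      field_simp
      ring
    rw [this, Real.sqrt_div (sq_nonneg a), Real.sqrt_sq ha]
  have h3 : Tendsto (fun a : ℝ => 2 * χ * (a / √(1 + a ^ 2)) - (1 - a / √(1 + a ^ 2)) * K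
      - P / (1 + a ^ 2)) atTop (𝓝 (2 * χ * 1 - (1 - 1) * K - 0)) :=
    ((h2.const_mul _).sub ((h2.const_sub 1).mul_const K)).sub (h1.const_div_atTop P)
  exact h3.eventually_const_lt (by linarith)

theorem grad_neg (w : M → ℝ) (y : M) : grad n (-w) y = -grad n w y := by
  rw [grad, mvfderiv_neg, map_neg]
  rfl

theorem levelTrace_neg
    (p : ∀ x : M, TangentSpace (𝓡 n) x →L[ℝ] TangentSpace (𝓡 n) x →L[ℝ] ℝ) (φ : M → ℝ) (y : M) :
    levelTrace (-p) φ y = -levelTrace p φ y := by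
  simp only [levelTrace, metricTrace, Pi.neg_apply, neg_apply, Finset.sum_neg_distrib]
  ring

variable [IsManifold (𝓡 n) ∞ M]
  [IsContMDiffRiemannianBundle (𝓡 n) ∞ (EuclideanSpace ℝ (Fin n))
    (fun x : M => TangentSpace (𝓡 n) x)]

theorem hess_neg (w : M → ℝ) (y : M) (u v : TangentSpace (𝓡 n) y) :
    hess n (-w) y u v = -hess n w y u v := by
  have h1 : fderiv ℝ (fderiv ℝ ((-w) ∘ (extChartAt (𝓡 n) y).symm)) (extChartAt (𝓡 n) y y)
      = -fderiv ℝ (fderiv ℝ (w ∘ (extChartAt (𝓡 n) y).symm)) (extChartAt (𝓡 n) y y) := by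
    have : fderiv ℝ ((-w) ∘ (extChartAt (𝓡 n) y).symm)
        = -fderiv ℝ (w ∘ (extChartAt (𝓡 n) y).symm) := by
      ext1 z
      exact fderiv_fun_neg
    rw [this]
    exact fderiv_neg
  have h2 : coordVec y (-grad n w y) = (-1 : ℝ) • coordVec y (grad n w y) := by
    rw [neg_one_smul]
    rfl
  rw [hess, h1, grad_neg, h2, christoffel_smul_right, hess, neg_apply, neg_apply]
  ring

/-- `mc` is odd in `w`, while `tr(p)` is even in `w` and linear in `p`. This symmetry exchanges sub
and super solutions. -/
theorem jangOp_neg (p : ∀ x : M, TangentSpace (𝓡 n) x →L[ℝ] TangentSpace (𝓡 n) x →L[ℝ] ℝ)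
    (t : ℝ) (w : M → ℝ) (y : M) : jangOp (-p) t (-w) y = -jangOp p t w y := by
  have h1 : graphMC n (-w) y = -graphMC n w y := by
    have h2 : hess n w y (-grad n w y) (-grad n w y) = hess n w y (grad n w y) (grad n w y) := by
      simpa using hess_smul_smul w y (-1) (grad n w y)
    simp only [graphMC, metricTrace, hess_neg, grad_neg, norm_neg, h2, Finset.sum_neg_distrib]
    ring
  have h2 : graphTrace (-p) (-w) y = -graphTrace p w y := by
    simp only [graphTrace, metricTrace, grad_neg, norm_neg, map_neg, neg_apply, Pi.neg_apply,
      Finset.sum_neg_distrib]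
    ring
  rw [jangOp, jangOp, h1, h2, Pi.neg_apply]
  ring

/-- At a critical point the Christoffel term vanishes, leaving the second derivative in the chart.
-/
theorem hess_nonneg_of_isLocalMin {w : M → ℝ} {y : M} (hw : ContMDiffAt (𝓡 n) 𝓘(ℝ) 2 w y)
    (h : IsLocalMin w y) :
    grad n w y = 0 ∧ ∀ v, 0 ≤ hess n w y v v := by
  have hcont := (continuousAt_extChartAt_symm (I := 𝓡 n) y).tendsto
  rw [extChartAt_to_inv] at hcont
  have hmin : IsLocalMin (w ∘ (extChartAt (𝓡 n) y).symm) (extChartAt (𝓡 n) y y) := by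
    filter_upwards [hcont.eventually h] with u hu
    simpa using hu
  have hg : grad n w y = 0 := by
    refine ext_inner_right ℝ fun v => ?_
    have := fderiv_eq_inner_grad y (hw.mdifferentiableAt two_ne_zero) (coordVec y v)
    rw [hmin.fderiv_eq_zero] at this
    rw [inner_zero_left]
    exact this.symm
  refine ⟨hg, fun v => ?_⟩
  have h0 : coordVec y (grad n w y) = (0 : ℝ) • (0 : EuclideanSpace ℝ (Fin n)) := by
    rw [hg, zero_smul]
    rfl
  rw [hess, h0, christoffel_smul_right, zero_mul, sub_zero]
  exact fderiv_fderiv_nonneg_of_isLocalMin (ContMDiffAt.contDiffAt_chart hw) hmin _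

theorem neg_le_graphMC_add_graphTrace_of_isLocalMin
    {p : ∀ x : M, TangentSpace (𝓡 n) x →L[ℝ] TangentSpace (𝓡 n) x →L[ℝ] ℝ} {y : M} {P : ℝ}
    (hP : ∀ v, |p y v v| ≤ P * ‖v‖ ^ 2) {w : M → ℝ} (hw : ContMDiffAt (𝓡 n) 𝓘(ℝ) 2 w y)
    (h : IsLocalMin w y) : -(n * P) ≤ graphMC n w y + graphTrace p w y := by
  obtain ⟨hg, hh⟩ := hess_nonneg_of_isLocalMin hw h
  have h1 : 0 ≤ graphMC n w y := by
    have h2 : hess n w y 0 0 = 0 := by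
      simpa using hess_smul_smul w y 0 0
    rw [graphMC, hg, h2, zero_div, sub_zero]
    exact div_nonneg (Finset.sum_nonneg fun i _ => hh _) (Real.sqrt_nonneg _)
  have h2 : graphTrace p w y = metricTrace y (fun v w => p y v w) := by
    rw [graphTrace, hg]
    simp
  have h3 := abs_metricTrace_le (B := fun v w => p y v w) hP
  rw [h2]
  linarith [(abs_le.1 h3).1]

/-- `p` is bounded by its supremum over a compact set. -/
theorem abs_tensor_le_tensorSup
    {p : ∀ x : M, TangentSpace (𝓡 n) x →L[ℝ] TangentSpace (𝓡 n) x →L[ℝ] ℝ}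
    (hp : ContMDiff (𝓡 n)
      ((𝓡 n).prod 𝓘(ℝ, EuclideanSpace ℝ (Fin n) →L[ℝ] EuclideanSpace ℝ (Fin n) →L[ℝ] ℝ)) ∞
      (fun x : M => TotalSpace.mk' (EuclideanSpace ℝ (Fin n) →L[ℝ] EuclideanSpace ℝ (Fin n) →L[ℝ] ℝ)
        x (p x))) {Ω : Set M} (hΩ : IsCompact (closure Ω)) {x : M} (hx : x ∈ closure Ω)
    (v : TangentSpace (𝓡 n) x) : |p x v v| ≤ tensorSup p Ω * ‖v‖ ^ 2 := by
  -- Some uniform bound is needed first: the real `sSup` of an unbounded set is the default `0`.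
  obtain ⟨K, hK⟩ : ∃ K : ℝ, ∀ x ∈ closure Ω, ∀ v : TangentSpace (𝓡 n) x,
      |p x v v| ≤ K * ‖v‖ ^ 2 := by
    refine hΩ.induction_on (p := fun A => ∃ K : ℝ, ∀ x ∈ A, ∀ v : TangentSpace (𝓡 n) x,
      |p x v v| ≤ K * ‖v‖ ^ 2) ⟨0, by simp⟩ (fun A B hAB ⟨K, hK⟩ => ⟨K, fun x hx => hK x (hAB hx)⟩)
      ?_ ?_
    · rintro A B ⟨K, hK⟩ ⟨K', hK'⟩
      refine ⟨max K K', ?_⟩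
      rintro x (hx | hx) v
      · exact (hK x hx v).trans (mul_le_mul_of_nonneg_right (le_max_left _ _) (sq_nonneg _))
      · exact (hK' x hx v).trans (mul_le_mul_of_nonneg_right (le_max_right _ _) (sq_nonneg _))
    · intro x _
      obtain ⟨K, hK⟩ := eventually_abs_tensor_le hp x
      exact ⟨_, nhdsWithin_le_nhds hK, K, fun z hz => hz⟩
  rcases eq_or_ne v 0 with rfl | hv
  · simp
  have hvn : 0 < ‖v‖ := norm_pos_iff.2 hv
  have h1 : |p x (‖v‖⁻¹ • v) (‖v‖⁻¹ • v)| ≤ tensorSup p Ω := by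
    refine le_csSup ⟨K, ?_⟩ ⟨x, hx, ‖v‖⁻¹ • v, by
      rw [norm_smul, norm_inv, norm_norm, inv_mul_cancel₀ hvn.ne'], rfl⟩
    rintro _ ⟨z, hz, u, hu, rfl⟩
    simpa [hu] using hK z hz u
  have h2 : p x (‖v‖⁻¹ • v) (‖v‖⁻¹ • v) = p x v v / ‖v‖ ^ 2 := by
    simp only [map_smul, smul_apply, smul_eq_mul]
    field_simp
  rwa [h2, abs_div, abs_of_pos (by positivity : 0 < ‖v‖ ^ 2), div_le_iff₀ (by positivity)] at h1

end Jang

end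

end JangPerron
namespace JangPerron

noncomputable section

variable {n : ℕ} {M : Type*}

/-! ### The barriers -/

section Barrier

variable [MetricSpace M]

theorem setDist_le_infDist_add_infDist {S T : Set M} (hS : S.Nonempty) (hT : T.Nonempty) (x : M) :
    setDist S T ≤ Metric.infDist x S + Metric.infDist x T := by
  have h : ∀ y ∈ S, ∀ z ∈ T, setDist S T ≤ dist x y + dist x z := fun y hy z hz => by
    have hbdd : BddBelow {d | ∃ y ∈ S, ∃ z ∈ T, d = dist y z} := by
      refine ⟨0, ?_⟩
      rintro _ ⟨y, -, z, -, rfl⟩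
      exact dist_nonneg
    have : setDist S T ≤ dist y z := csInf_le hbdd ⟨y, hy, z, hz, rfl⟩
    exact this.trans (dist_triangle_left y z x)
  have h1 : ∀ y ∈ S, setDist S T - dist x y ≤ Metric.infDist x T := fun y hy =>
    (Metric.le_infDist hT).2 fun z hz => by linarith [h y hy z hz]
  have h2 : setDist S T - Metric.infDist x T ≤ Metric.infDist x S :=
    (Metric.le_infDist hS).2 fun y hy => by linarith [h1 y hy]
  linarith

/-- Within `δ` of `S` the other component is more than `4δ` away, so the distance to the frontier is
that to `S`. The branches meet at distance `δ`, since the slope times `δ` is `χ/t + C/t`. The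
maximum gives continuity and lets either branch touch from below. -/
theorem lowerBarrier_eq_max {Ω S T : Set M} {C χ δ t : ℝ} (hΩ : frontier Ω = S ∪ T)
    (hS : S.Nonempty) (hT : T.Nonempty) (hχ : χ ∈ Ioo 0 C) (hδ : δ ∈ Ioo 0 ((1 / 5) * setDist S T))
    (ht : 0 < t) (x : M) :
    lowerBarrier Ω S C χ δ t x
      = max (χ / t - (χ + C) / (t * δ) * Metric.infDist x S) (-(C / t)) := by
  obtain ⟨hχ0, hχC⟩ := hχ
  obtain ⟨hδ0, hδ1⟩ := hδ
  have hslope : (χ + C) / (t * δ) * δ = χ / t + C / t := by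
    field_simp
  have ha : 0 < (χ + C) / (t * δ) := by
    have : 0 < χ + C := by linarith
    positivity
  rw [lowerBarrier]
  split_ifs with h
  · have h1 : Metric.infDist x (frontier Ω) = Metric.infDist x S := by
      rw [hΩ]
      refine le_antisymm (Metric.infDist_le_infDist_of_subset subset_union_left hS)
        ((Metric.le_infDist hS.inl).2 ?_)
      rintro y (hy | hy)
      · exact Metric.infDist_le_dist_of_mem hy
      · have := Metric.infDist_le_dist_of_mem (x := x) hy
        linarith [setDist_le_infDist_add_infDist hS hT x]
    rw [h1, max_eq_left]
    linarith [mul_le_mul_of_nonneg_left h ha.le]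
  · rw [max_eq_right]
    linarith [mul_le_mul_of_nonneg_left (not_le.1 h).le ha.le]

theorem upperBarrier_eq_neg_lowerBarrier (Ω S : Set M) (C χ δ t : ℝ) :
    upperBarrier Ω S C χ δ t = -lowerBarrier Ω S C χ δ t := by
  ext x
  rw [Pi.neg_apply, upperBarrier, lowerBarrier]
  split_ifs <;> ring

/-- The two collars are disjoint, so at each point at least one barrier takes its extreme value
`±C/t`, and `χ < C` separates it from the other. -/
theorem lowerBarrier_lt_upperBarrier (Ω : Set M) {S T : Set M} {C χ δ t : ℝ} (hS : S.Nonempty) (hT : T.Nonempty) (hχ : χ ∈ Ioo 0 C) (hδ : δ ∈ Ioo 0 ((1 / 5) * setDist S T))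
    (ht : 0 < t) (x : M) : lowerBarrier Ω S C χ δ t x < upperBarrier Ω T C χ δ t x := by
  obtain ⟨hχ0, hχC⟩ := hχ
  obtain ⟨hδ0, hδ1⟩ := hδ
  have h1 : χ / t < C / t := div_lt_div_of_pos_right hχC ht
  have h2 : 0 < χ / t := by positivity
  have h3 : ∀ z, 0 ≤ (χ + C) / (t * δ) * Metric.infDist z (frontier Ω) := fun z => by
    have : 0 < χ + C := by linarith
    have := Metric.infDist_nonneg (x := z) (s := frontier Ω)
    positivity
  have h4 := setDist_le_infDist_add_infDist hS hT x
  rw [lowerBarrier, upperBarrier]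
  split_ifs
  · linarith
  · linarith [h3 x]
  · linarith [h3 x]
  · linarith

theorem le_lowerBarrier {Ω S T : Set M} {C χ δ t : ℝ} (hΩ : frontier Ω = S ∪ T)
    (hS : S.Nonempty) (hT : T.Nonempty) (hχ : χ ∈ Ioo 0 C) (hδ : δ ∈ Ioo 0 ((1 / 5) * setDist S T))
    (ht : 0 < t) {x : M} (hx : Metric.infDist x S ≤ χ * δ / (2 * (χ + C))) :
    χ / (2 * t) ≤ lowerBarrier Ω S C χ δ t x := by
  rw [lowerBarrier_eq_max hΩ hS hT hχ hδ ht]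
  refine le_max_of_le_left ?_
  have hχC : 0 < χ + C := by linarith [hχ.1, hχ.2]
  have hδ0 := hδ.1
  have h1 := mul_le_mul_of_nonneg_left hx (by positivity : 0 ≤ (χ + C) / (t * δ))
  have h2 : (χ + C) / (t * δ) * (χ * δ / (2 * (χ + C))) = χ / (2 * t) := by
    field_simp
  have h3 : χ / t = χ / (2 * t) + χ / (2 * t) := by
    field_simp
    ring
  linarith

variable [ChartedSpace (EuclideanSpace ℝ (Fin n)) M]
  [RiemannianBundle (fun x : M => TangentSpace (𝓡 n) x)]

theorem closedBall_subset_of_lt_perronRadius [IsRiemannianManifold (𝓡 n) M]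
    {Ω : Set M} {r₀ : M → ℝ} {δ : ℝ} {x : M} (hx : x ∈ Ω)
    {r : ℝ} (hr : r ∈ Ioo 0 (perronRadius n Ω r₀ δ x)) : Metric.closedBall x r ⊆ Ω := by
  intro z hz
  by_contra hzΩ
  have h1 := infDist_frontier_le_dist n hx hzΩ
  have h2 : perronRadius n Ω r₀ δ x ≤ (1 / 2) * Metric.infDist x (frontier Ω) :=
    -- The injectivity radius may be `∞`; the finite distance term bounds the minimum before it is
    -- turned into a real number.
    (min_le_left _ _).trans (mul_le_mul_of_nonneg_left (ENNReal.toReal_le_of_le_ofReal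
      Metric.infDist_nonneg ((min_le_left _ _).trans (min_le_right _ _))) (by norm_num))
  rw [Metric.mem_closedBall, dist_comm] at hz
  linarith [hr.1, hr.2]

variable [IsManifold (𝓡 n) ∞ M]
  [IsContMDiffRiemannianBundle (𝓡 n) ∞ (EuclideanSpace ℝ (Fin n))
    (fun x : M => TangentSpace (𝓡 n) x)]

theorem IsPerronSub.isPerronSuper_neg
    {p : ∀ x : M, TangentSpace (𝓡 n) x →L[ℝ] TangentSpace (𝓡 n) x →L[ℝ] ℝ}
    {Ω : Set M} {C t : ℝ} {rD u : M → ℝ} (h : IsPerronSub (-p) Ω C rD t u) :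
    IsPerronSuper p Ω C rD t (-u) := by
  refine ⟨h.continuousOn.neg, fun x hx => ?_, fun x hx r hr w hw y hy => ?_⟩
  · rw [Pi.neg_apply, abs_neg]
    exact h.bound x hx
  · have := h.le_solution x hx r hr (-w) ⟨hw.continuousOn.neg, hw.contMDiffOn.neg, fun z hz => by
      rw [jangOp_neg, hw.eq_zero z hz, neg_zero], fun z hz => by
      rw [Pi.neg_apply, hw.boundary z hz, Pi.neg_apply, neg_neg]⟩ y hy
    exact le_neg_of_le_neg this

variable [CompleteSpace M] [IsRiemannianManifold (𝓡 n) M]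

theorem isPerronSub_lowerBarrier
    {p : ∀ x : M, TangentSpace (𝓡 n) x →L[ℝ] TangentSpace (𝓡 n) x →L[ℝ] ℝ}
    {Ω S T : Set M} (hΩ_open : IsOpen Ω) (hΩ : frontier Ω = S ∪ T) (hS_closed : IsClosed S)
    (hS : S.Nonempty) (hT : T.Nonempty) {C χ δ P : ℝ}
    (hP : ∀ x ∈ closure Ω, ∀ v : TangentSpace (𝓡 n) x, |p x v v| ≤ P * ‖v‖ ^ 2) (hC : n * P < C)
    (hχ : χ ∈ Ioo 0 C) (hδ : δ ∈ Ioo 0 ((1 / 5) * setDist S T))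
    (hleaf : ∀ γ ∈ Icc 0 (2 * δ), ∀ y ∈ distSurface Ω S γ,
      (∃ φ : M → ℝ, IsBoundaryDefining n (distInterior Ω S γ) y φ) ∧
      ∀ φ : M → ℝ, IsBoundaryDefining n (distInterior Ω S γ) y φ →
        2 * χ ≤ levelMC n φ y + levelTrace p φ y)
    {r₀ : M → ℝ} {t : ℝ} (ht : 0 < t) {a : ℝ} (ha : a = (χ + C) / (t * δ))
    (hbig : χ < 2 * χ * (a / √(1 + a ^ 2)) - (1 - a / √(1 + a ^ 2)) * ((n + 1) * P)
      - P / (1 + a ^ 2)) :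
    IsPerronSub p Ω C (perronRadius n Ω r₀ δ) t (lowerBarrier Ω S C χ δ t) := by
  have hχt : χ / t < C / t := div_lt_div_of_pos_right hχ.2 ht
  have hχ0 : 0 < χ / t := div_pos hχ.1 ht
  have ha0 : 0 < a := by
    have h1 : 0 < χ + C := by linarith [hχ.1, hχ.2]
    have h2 := hδ.1
    rw [ha]
    positivity
  have haδ : a * δ = χ / t + C / t := by
    have h2 := hδ.1
    rw [ha]
    field_simp
  have hu := lowerBarrier_eq_max hΩ hS hT hχ hδ ht
  rw [← ha] at hu
  set u := lowerBarrier Ω S C χ δ t with hudef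
  have hcont : Continuous u := by
    rw [funext hu]
    exact ((continuous_const.sub ((Metric.continuous_infDist_pt S).const_mul a)).max
      continuous_const)
  refine ⟨hcont.continuousOn, fun x _ => ?_, fun x hx r hr w hw => ?_⟩
  · rw [hu, abs_le]
    have := mul_nonneg ha0.le (Metric.infDist_nonneg (x := x) (s := S))
    exact ⟨le_max_right _ _, max_le (by linarith) (by linarith)⟩
  have hball := closedBall_subset_of_lt_perronRadius hx hr
  have hproper := properSpace_of_complete (M := M) n
  -- The minimum of `w - u` is attained. If negative, it is interior, because `w = u` on the sphere.
  obtain ⟨y, hy, hmin⟩ := (isCompact_closedBall x r).exists_isMinOn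
    (Metric.nonempty_closedBall.2 hr.1.le) (hw.continuousOn.sub hcont.continuousOn)
  by_contra! hneg
  obtain ⟨z, hz, hwz⟩ := hneg
  have hwy : w y < u y := by
    have := isMinOn_iff.1 hmin z hz
    simp only [Pi.sub_apply] at this
    linarith
  have hy' : y ∈ Metric.ball x r := by
    rw [Metric.mem_ball]
    exact lt_of_le_of_ne hy fun h => hwy.ne (hw.boundary y h)
  have hnhds := Metric.isOpen_ball.mem_nhds hy'
  have hw2 : ContMDiffAt (𝓡 n) 𝓘(ℝ) 2 w y := (hw.contMDiffOn y hy').contMDiffAt hnhds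
  have hloc : ∀ᶠ q in 𝓝 y, u q - u y ≤ w q - w y := by
    filter_upwards [hnhds] with q hq
    have := isMinOn_iff.1 hmin q (Metric.ball_subset_closedBall hq)
    simp only [Pi.sub_apply] at this
    linarith
  have hyΩ : y ∈ Ω := hball hy
  have hyP := hP y (subset_closure hyΩ)
  have hjang := hw.eq_zero y hy'
  rw [jangOp] at hjang
  have htw := mul_lt_mul_of_pos_left hwy ht
  -- At distance exactly `δ` both branches are active; the constant one is used, which makes `y` a
  -- local minimum of `w`.
  rcases le_or_gt δ (Metric.infDist y S) with hd | hd
  · have huy : u y = -(C / t) := by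
      rw [hu, max_eq_right]
      linarith [mul_le_mul_of_nonneg_left hd ha0.le]
    have hwmin : IsLocalMin w y := by
      filter_upwards [hloc] with q hq
      have : -(C / t) ≤ u q := by
        rw [hu]
        exact le_max_right _ _
      linarith
    have h1 := neg_le_graphMC_add_graphTrace_of_isLocalMin hyP hw2 hwmin
    rw [huy, mul_neg, mul_div_cancel₀ _ ht.ne'] at htw
    linarith
  · have huy : u y = χ / t - a * Metric.infDist y S := by
      rw [hu, max_eq_left]
      linarith [mul_le_mul_of_nonneg_left hd.le ha0.le]
    have hloc' : ∀ᶠ q in 𝓝 y, a * (Metric.infDist y S - Metric.infDist q S) ≤ w q - w y := by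
      filter_upwards [hloc] with q hq
      have : χ / t - a * Metric.infDist q S ≤ u q := by
        rw [hu]
        exact le_max_left _ _
      linarith
    have hyS : y ∉ S := fun h => by
      have h1 : y ∈ frontier Ω := hΩ ▸ Or.inl h
      rw [hΩ_open.frontier_eq] at h1
      exact h1.2 hyΩ
    have hd0 : 0 < Metric.infDist y S := (hS_closed.notMem_iff_infDist_pos hS).1 hyS
    obtain ⟨hgrad, hhess⟩ := norm_grad_eq_and_hess_nonneg hw2 ha0 hS hd0 hloc'
    have hg : grad n w y ≠ 0 := by
      rw [← norm_pos_iff, hgrad]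
      exact ha0
    obtain ⟨⟨φ, hφ⟩, hlow⟩ := hleaf (Metric.infDist y S) ⟨hd0.le, by linarith [hδ.1]⟩ y
      ⟨subset_closure hyΩ, rfl⟩
    have hχφ := hlow φ hφ
    obtain ⟨hφy, hφ', U, hU, hyU, hφU, hφΩ⟩ := hφ
    -- Near `y`, `φ ≥ 0` means that the distance to `S` is at most its value at `y`, and there `w ≥
    -- w(y)`.
    have hUn := hU.mem_nhds hyU
    obtain ⟨hmc, htr⟩ := levelMC_le_levelMC p hw2
      (((hφU y hyU).contMDiffAt hUn).of_le (WithTop.coe_le_coe.2 le_top)) hφy hφ' hg (by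
        filter_upwards [hloc', hUn, hΩ_open.mem_nhds hyΩ] with q hq hqU hqΩ hφq
        have h1 : Metric.infDist q S ≤ Metric.infDist y S := by
          by_contra! h2
          exact (((hφΩ q hqU).1 ⟨hqΩ, h2⟩).trans_le hφq).false
        linarith [mul_nonneg ha0.le (sub_nonneg.2 h1)])
    have h1 := le_graphMC_add_graphTrace hyP ha0 hgrad hhess (χ := 2 * χ) (by linarith)
    -- The equation gives `mc + tr(p) = t w(y) < χ - t a d(y) < χ`, against the lower bound from
    -- `hbig`.
    rw [huy, mul_sub, mul_div_cancel₀ _ ht.ne'] at htw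
    have h2 : 0 < t * (a * Metric.infDist y S) := by positivity
    linarith

end Barrier

end

end JangPerron

/-! ### The barrier theorem: choice of `t₀` and reflection -/

theorem mainTheorem9 {n : ℕ} {M : Type*} [MetricSpace M] [CompleteSpace M]
    [ChartedSpace (EuclideanSpace ℝ (Fin n)) M] [IsManifold (𝓡 n) ∞ M]
    [RiemannianBundle (fun x : M => TangentSpace (𝓡 n) x)]
    [IsContMDiffRiemannianBundle (𝓡 n) ∞ (EuclideanSpace ℝ (Fin n))
      (fun x : M => TangentSpace (𝓡 n) x)]
    [IsRiemannianManifold (𝓡 n) M]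
    -- the symmetric tensor field `p`
    (p : ∀ x : M, TangentSpace (𝓡 n) x →L[ℝ] TangentSpace (𝓡 n) x →L[ℝ] ℝ)
    (hp_smooth : ContMDiff (𝓡 n)
      ((𝓡 n).prod 𝓘(ℝ, EuclideanSpace ℝ (Fin n) →L[ℝ] EuclideanSpace ℝ (Fin n) →L[ℝ] ℝ)) ∞
      (fun x : M => TotalSpace.mk' (EuclideanSpace ℝ (Fin n) →L[ℝ] EuclideanSpace ℝ (Fin n) →L[ℝ] ℝ)
        x (p x)))
    (hp_symm : ∀ (x : M) (v w : TangentSpace (𝓡 n) x), p x v w = p x w v)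
    -- the domain `Ω` and the two parts `S₁ = ∂₁Ω`, `S₂ = ∂₂Ω` of its boundary
    (Ω S₁ S₂ : Set M) (hΩ_open : IsOpen Ω) (hΩ_conn : IsConnected Ω)
    (hΩ_bdd : Bornology.IsBounded Ω)
    (hΩ_smooth : ∀ y ∈ frontier Ω, ∃ φ : M → ℝ, JangPerron.IsBoundaryDefining n Ω y φ)
    (hS : frontier Ω = S₁ ∪ S₂) (hS_disj : Disjoint S₁ S₂)
    (hS₁ : IsClosed S₁) (hS₂ : IsClosed S₂) (hS₁_ne : S₁.Nonempty) (hS₂_ne : S₂.Nonempty)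
    -- the one-sided trapping assumptions
    (htrap₁ : ∀ y ∈ S₁, ∀ φ : M → ℝ, JangPerron.IsBoundaryDefining n Ω y φ →
      0 < JangPerron.levelMC n φ y + JangPerron.levelTrace p φ y)
    (htrap₂ : ∀ y ∈ S₂, ∀ φ : M → ℝ, JangPerron.IsBoundaryDefining n Ω y φ →
      0 < JangPerron.levelMC n φ y - JangPerron.levelTrace p φ y)
    -- the constants `C`, `χ`, `δ` and the radius function `r₀`
    (C χ δ : ℝ) (hC : (n : ℝ) * JangPerron.tensorSup p Ω < C)
    (hχ : χ ∈ Ioo 0 C) (hδ : δ ∈ Ioo 0 ((1 / 5) * JangPerron.setDist S₁ S₂))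
    (hleaf₁ : ∀ γ ∈ Icc 0 (2 * δ), ∀ y ∈ JangPerron.distSurface Ω S₁ γ,
      (∃ φ : M → ℝ, JangPerron.IsBoundaryDefining n (JangPerron.distInterior Ω S₁ γ) y φ) ∧
      ∀ φ : M → ℝ, JangPerron.IsBoundaryDefining n (JangPerron.distInterior Ω S₁ γ) y φ →
        2 * χ ≤ JangPerron.levelMC n φ y + JangPerron.levelTrace p φ y)
    (hleaf₂ : ∀ γ ∈ Icc 0 (2 * δ), ∀ y ∈ JangPerron.distSurface Ω S₂ γ,
      (∃ φ : M → ℝ, JangPerron.IsBoundaryDefining n (JangPerron.distInterior Ω S₂ γ) y φ) ∧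
      ∀ φ : M → ℝ, JangPerron.IsBoundaryDefining n (JangPerron.distInterior Ω S₂ γ) y φ →
        2 * χ ≤ JangPerron.levelMC n φ y - JangPerron.levelTrace p φ y)
    (r₀ : M → ℝ) (hr₀ : JangPerron.IsMeanConvexRadius n Ω C r₀) :
    ∃ t₀ > 0, ∀ t ∈ Ioo 0 t₀,
      JangPerron.IsPerronSub p Ω C (JangPerron.perronRadius n Ω r₀ δ) t
        (JangPerron.lowerBarrier Ω S₁ C χ δ t) ∧
      JangPerron.IsPerronSuper p Ω C (JangPerron.perronRadius n Ω r₀ δ) t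
        (JangPerron.upperBarrier Ω S₂ C χ δ t) ∧
      (∀ x ∈ Ω, JangPerron.lowerBarrier Ω S₁ C χ δ t x
        < JangPerron.upperBarrier Ω S₂ C χ δ t x) ∧
      (∀ x ∈ closure Ω, Metric.infDist x S₁ ≤ χ * δ / (2 * (χ + C)) →
        χ / (2 * t) ≤ JangPerron.lowerBarrier Ω S₁ C χ δ t x) ∧
      (∀ x ∈ closure Ω, Metric.infDist x S₂ ≤ χ * δ / (2 * (χ + C)) →
        JangPerron.upperBarrier Ω S₂ C χ δ t x ≤ -(χ / (2 * t))) := by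
  have hproper := JangPerron.properSpace_of_complete (M := M) n
  have hP : ∀ x ∈ closure Ω, ∀ v : TangentSpace (𝓡 n) x,
      |p x v v| ≤ JangPerron.tensorSup p Ω * ‖v‖ ^ 2 := fun x hx v =>
    JangPerron.abs_tensor_le_tensorSup hp_smooth hΩ_bdd.isCompact_closure hx v
  have hP' : ∀ x ∈ closure Ω, ∀ v : TangentSpace (𝓡 n) x,
      |(-p) x v v| ≤ JangPerron.tensorSup p Ω * ‖v‖ ^ 2 := fun x hx v => by
    rw [Pi.neg_apply, neg_apply, neg_apply, abs_neg]
    exact hP x hx v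
  have hS' : frontier Ω = S₂ ∪ S₁ := hS.trans (union_comm _ _)
  have hδ' : δ ∈ Ioo 0 ((1 / 5) * JangPerron.setDist S₂ S₁) := by
    have : JangPerron.setDist S₂ S₁ = JangPerron.setDist S₁ S₂ := by
      refine congrArg sInf (Set.ext fun d => ⟨?_, ?_⟩)
      · rintro ⟨y, hy, z, hz, rfl⟩
        exact ⟨z, hz, y, hy, dist_comm _ _⟩
      · rintro ⟨y, hy, z, hz, rfl⟩
        exact ⟨z, hz, y, hy, dist_comm _ _⟩
    rwa [this]
  have hδ0 := hδ.1
  have hχC : 0 < χ + C := by linarith [hχ.1, hχ.2]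
  obtain ⟨A, hA⟩ := eventually_atTop.1 (JangPerron.eventually_lt_slope_bound hχ.1
    ((n + 1) * JangPerron.tensorSup p Ω) (JangPerron.tensorSup p Ω))
  have hA0 : 0 < max A 1 := lt_max_of_lt_right one_pos
  -- At this value of `t` the slope `(χ + C) / (t δ)` equals `max A 1`, and it is larger for smaller
  -- `t`. The `1` keeps `t₀` positive.
  refine ⟨(χ + C) / (max A 1 * δ), by positivity, fun t ht => ?_⟩
  have ht0 : 0 < t := ht.1
  have hbig := hA ((χ + C) / (t * δ)) (by
    have h1 := (lt_div_iff₀ (by positivity)).1 ht.2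
    rw [le_div_iff₀ (by positivity)]
    nlinarith [mul_le_mul_of_nonneg_right (le_max_left A 1) (by positivity : 0 ≤ t * δ)])
  refine ⟨JangPerron.isPerronSub_lowerBarrier hΩ_open hS hS₁ hS₁_ne hS₂_ne hP hC hχ hδ hleaf₁ ht0
    rfl hbig, ?_, fun x _ => JangPerron.lowerBarrier_lt_upperBarrier Ω hS₁_ne hS₂_ne hχ hδ ht0 x,
    fun x _ hx => JangPerron.le_lowerBarrier hS hS₁_ne hS₂_ne hχ hδ ht0 hx, fun x _ hx => ?_⟩
  · rw [JangPerron.upperBarrier_eq_neg_lowerBarrier]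
    refine (JangPerron.isPerronSub_lowerBarrier hΩ_open hS' hS₂ hS₂_ne hS₁_ne hP' hC hχ hδ'
      (fun γ hγ y hy => ?_) ht0 rfl hbig).isPerronSuper_neg
    refine ⟨(hleaf₂ γ hγ y hy).1, fun φ hφ => ?_⟩
    rw [JangPerron.levelTrace_neg, ← sub_eq_add_neg]
    exact (hleaf₂ γ hγ y hy).2 φ hφ
  · rw [JangPerron.upperBarrier_eq_neg_lowerBarrier]
    exact neg_le_neg (JangPerron.le_lowerBarrier hS' hS₂_ne hS₁_ne hχ hδ' ht0 hx)
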